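/- **Setting.** Let $F$ be a global field (a number field or a finite extension of some $\mathbb{F}_p(t)$), with algebraic closure $\overline F$ and set of places $M(F)$. For $v\in M(F)$ let $F_v$ be the completion, $\mathbb{C}_v$ the completion of an algebraic closure of $F_v$, and $|\cdot|_v$ the extension to $\mathbb{C}_v$ of the normalized absolute value of $F_v$ (at a nonarchimedean place a uniformizer has absolute value $1/q_v$ with $q_v$ the order of the residue field; at a real place it is the usual absolute value, at a complex place its square). Let $X$ be a normal projective variety (integral, normal) of dimension $d\ge 1$ over $F$ with a given closed embedding $X\hookrightarrow\mathbb{P}^t_F$, and let $X_1$ be an ample effective Cartier divisor on $X$. **Adelic sets.** A product $\mathbb{E}=\prod_{v\in M(F)}E_v$ of subsets $E_v\subset (X\smallsetminus X_1)(\mathbb{C}_v)$ satisfies the *standard hypotheses* if (i) each $E_v$ is nonempty and stable under the group of continuous automorphisms of $\mathbb{C}_v$ over $F_v$; (ii) each $E_v$ is bounded away from $\mathrm{supp}(X_1)(\mathbb{C}_v)$ in the $v$-adic metric induced by the embedding in $\mathbb{P}^t$, and for all but finitely many $v$ the sets $E_v$ and $\mathrm{supp}(X_1)(\mathbb{C}_v)$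 have disjoint reductions modulo $v$. Such an $\mathbb{E}$ is called an adelic set. Let $\mathcal{U}(\mathbb{E})$ be the set of open adelic neighborhoods of $\mathbb{E}$: the products $\mathbb{U}=\prod_v U_v$ satisfying the standard hypotheses with every $U_v$ open in $X(\mathbb{C}_v)$ and $E_v\subset U_v$. **Capacity.** Let $H=\{y_1=0\}\subset\mathbb{P}^d_F$, with affine coordinates $z_i=y_i/y_1$ ($2\le i\le d+1$) on the complement of $H$. Let $\mathcal{R}$ be the set of functions $r:M(F)\to[0,\infty)$ with $r(v)=1$ for almost all $v$; put $|r|=\prod_v r(v)$ and $B(r)=\prod_v B_v(r(v))$, where $B_v(\rho)=\{z:|z_i|_v\le\rho\text{ for all }i\}\subset(\mathbb{P}^d\smallsetminus H)(\mathbb{C}_v)$. Let $T(X_1)$ be the set of finite morphisms $\pi:X\to\mathbb{P}^d_F$ over $F$ such that $\pi^{-1}(H)=m(\pi)X_1$ as Cartier divisors for some integer $m(\pi)>0$. For $\mathbb{U}\in\mathcal{U}(\mathbb{E})$ let $\gamma_{\mathrm F}(\mathbb{U},X_1)$ be the supremum of $$|r|^{\,d\cdot\deg(\pi)/m(\pi)^{d+1}}$$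 over all $\pi\in T(X_1)$ and $r\in\mathcal{R}$ with $\pi^{-1}(B(r))\subset\mathbb{U}$ (and $0$ if there are none), and put $\gamma_{\mathrm F}(\mathbb{E},X_1)=\inf_{\mathbb{U}\in\mathcal{U}(\mathbb{E})}\gamma_{\mathrm F}(\mathbb{U},X_1)$. **Theorem.** Let $\mathbb{E}$ be an adelic set. If $\gamma_{\mathrm F}(\mathbb{E},X_1)>1$, then for every open adelic neighborhood $\mathbb{U}\in\mathcal{U}(\mathbb{E})$ the set of points of $X(\overline F)$ all of whose Galois conjugates lie in $\mathbb{U}$ (that is, whose image under every $F$-embedding $\overline F\to\mathbb{C}_v$ lies in $U_v$, for every $v$) is Zariski dense. -/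

import Mathlib

open AlgebraicGeometry CategoryTheory

namespace FiniteMorphismCapacity

noncomputable section

/-! ### Global fields, places, and the fields `ℂ_v` -/

/-- A global field: a number field, or a finite extension of `𝔽_p(t)` for a prime `p`. -/
def IsGlobalField (F : Type) [Field F] : Prop :=
  NumberField F ∨
    ∃ (p : ℕ) (_ : Fact p.Prime) (_ : Algebra (RatFunc (ZMod p)) F), FunctionField (ZMod p) F

section Places

variable {F : Type} [Field F]

/-- The valuation ring `{x | v x ≤ 1}` of a nonarchimedean absolute value. -/
def valuationRing (v : AbsoluteValue F ℝ) (hv : IsNonarchimedean v) : Subring F where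
  carrier := {x | v x ≤ 1}
  zero_mem' := by simp
  one_mem' := by simp
  add_mem' {a b} ha hb := (hv a b).trans (max_le ha hb)
  mul_mem' {a b} ha hb := by
    change v (a * b) ≤ 1
    rw [map_mul]
    exact mul_le_one₀ ha (v.nonneg b) hb
  neg_mem' {a} ha := by simpa using ha

/-- The maximal ideal `{x | v x < 1}` of the valuation ring. -/
def maximalIdeal (v : AbsoluteValue F ℝ) (hv : IsNonarchimedean v) :
    Ideal (valuationRing v hv) where
  carrier := {x | v x < 1}
  zero_mem' := by simp
  add_mem' {a b} ha hb := (hv a b).trans_lt (max_lt ha hb)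
  smul_mem' c x hx := by
    have hc : v (c : F) ≤ 1 := c.2
    have hx' : v (x : F) < 1 := hx
    change v ((c : F) * (x : F)) < 1
    rw [map_mul]
    exact (mul_le_of_le_one_left (v.nonneg _) hc).trans_lt hx'

variable (F) in
/-- A nonarchimedean place, given by its unique normalized representative: a nontrivial
nonarchimedean absolute value whose largest value below `1` is `1 / q`, where `q` is the number of
elements of the residue field. (For a global field every nontrivial nonarchimedean absolute value
is discrete with finite residue field, so each equivalence class has exactly one such
representative.) -/
structure NonarchPlace where
  /-- the normalized absolute value -/
  abv : AbsoluteValue F ℝ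
  nonarch : IsNonarchimedean abv
  nontrivial : abv.IsNontrivial
  normalized : IsGreatest {r : ℝ | r < 1 ∧ ∃ x : F, abv x = r}
    ((Nat.card (valuationRing abv nonarch ⧸ maximalIdeal abv nonarch) : ℝ)⁻¹)

variable (F) in
/-- The set `M(F)` of places of `F`. -/
inductive Place where
  | arch (w : NumberField.InfinitePlace F)
  | nonarch (w : NonarchPlace F)

namespace NonarchPlace

/-- The completion `F_w`. -/
abbrev Completion (w : NonarchPlace F) : Type := w.abv.Completion

instance (w : NonarchPlace F) : IsUltrametricDist w.Completion := by
  refine IsUltrametricDist.isUltrametricDist_of_forall_norm_add_le_max_norm fun x y => ?_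
  induction x, y using UniformSpace.Completion.induction_on₂ with
  | hp =>
    exact isClosed_le (by fun_prop) (by fun_prop)
  | ih a b =>
    rw [← UniformSpace.Completion.coe_add, UniformSpace.Completion.norm_coe,
      UniformSpace.Completion.norm_coe, UniformSpace.Completion.norm_coe]
    exact w.nonarch a.ofAbs b.ofAbs

instance (w : NonarchPlace F) : NontriviallyNormedField w.Completion :=
  { (inferInstance : NormedField w.Completion) with
    non_trivial := by
      obtain ⟨x, hx0, hx1⟩ := w.nontrivial
      have key : ∀ y : F, ‖((WithAbs.toAbs w.abv y : WithAbs w.abv) : w.Completion)‖ = w.abv y :=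
        fun y => UniformSpace.Completion.norm_coe _
      rcases lt_or_gt_of_ne hx1 with h | h
      · refine ⟨((WithAbs.toAbs w.abv x⁻¹ : WithAbs w.abv) : w.Completion), ?_⟩
        rw [key, map_inv₀]
        exact (one_lt_inv₀ (w.abv.pos hx0)).2 h
      · exact ⟨((WithAbs.toAbs w.abv x : WithAbs w.abv) : w.Completion), by rwa [key]⟩ }

/-- An algebraic closure of `F_w`, normed by the unique extension of the absolute value. -/
def AlgCl (w : NonarchPlace F) : Type := AlgebraicClosure w.Completion

instance (w : NonarchPlace F) : Field w.AlgCl :=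
  inferInstanceAs (Field (AlgebraicClosure w.Completion))

instance (w : NonarchPlace F) : Algebra w.Completion w.AlgCl :=
  inferInstanceAs (Algebra w.Completion (AlgebraicClosure w.Completion))

instance (w : NonarchPlace F) : Algebra.IsAlgebraic w.Completion w.AlgCl :=
  inferInstanceAs (Algebra.IsAlgebraic w.Completion (AlgebraicClosure w.Completion))

instance (w : NonarchPlace F) : NormedField w.AlgCl := spectralNorm.normedField w.Completion w.AlgCl

/-- The completion of the algebraic closure of `F_w`. -/
abbrev Cw (w : NonarchPlace F) : Type := UniformSpace.Completion w.AlgCl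

/-- The canonical embedding of `F` in the completed algebraic closure of `F_w`. -/
def embedding (w : NonarchPlace F) : F →+* w.Cw :=
  (UniformSpace.Completion.coeRingHom (α := w.AlgCl)).comp <|
    (algebraMap w.Completion w.AlgCl).comp <|
      (UniformSpace.Completion.coeRingHom (α := WithAbs w.abv)).comp
        (WithAbs.equiv w.abv).symm.toRingHom

end NonarchPlace

namespace Place

/-- The field `ℂ_v`, the completion of an algebraic closure of the completion `F_v`. -/
def Cv : Place F → Type
  | arch _ => ℂ
  | nonarch w => w.Cw

instance instNormedField : (v : Place F) → NormedField v.Cv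
  | arch _ => inferInstanceAs (NormedField ℂ)
  | nonarch w => inferInstanceAs (NormedField w.Cw)

/-- The canonical embedding of `F` in `ℂ_v`. -/
def embedding : (v : Place F) → F →+* v.Cv
  | arch w => w.embedding
  | nonarch w => w.embedding

instance (v : Place F) : Algebra F v.Cv := v.embedding.toAlgebra

/-- The exponent that turns the norm of `ℂ_v` into the normalized absolute value: it is `2` at
complex places and `1` at all other places. -/
def mult : Place F → ℕ
  | arch w => w.mult
  | nonarch _ => 1

/-- The normalized absolute value `|z|_v` on `ℂ_v` (the square of the usual one at a complex
place). -/
def nabs (v : Place F) (z : v.Cv) : ℝ := ‖z‖ ^ v.mult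

end Place

end Places

/-! ### Points with values in a field -/

section Points

variable {F : Type} [Field F] {X : Scheme.{0}}

/-- The set `X(C)` of points of the `F`-scheme `X` with values in an extension field `C` of `F`. -/
def Points (f : X ⟶ Spec (.of F)) (C : Type) [Field C] [Algebra F C] : Type :=
  {x : Spec (.of C) ⟶ X // x ≫ f = Spec.map (CommRingCat.ofHom (algebraMap F C))}

namespace Points

variable {f : X ⟶ Spec (.of F)} {C C' : Type} [Field C] [Algebra F C] [Field C'] [Algebra F C']

/-- The underlying point of the scheme. -/
def pt (x : Points f C) : X := x.1 (IsLocalRing.closedPoint C)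

/-- The map `X(C) → X(C')` induced by a homomorphism of extension fields of `F`. -/
def baseChange (φ : C →ₐ[F] C') (x : Points f C) : Points f C' :=
  ⟨Spec.map (CommRingCat.ofHom φ.toRingHom) ≫ x.1, by
    rw [Category.assoc, x.2, ← Spec.map_comp, ← CommRingCat.ofHom_comp]
    congr 2
    exact φ.comp_algebraMap⟩

/-- The map `X(C) → Y(C)` induced by a morphism of `F`-schemes. -/
def push {Y : Scheme.{0}} {g : Y ⟶ Spec (.of F)} (π : X ⟶ Y) (hπ : π ≫ g = f)
    (x : Points f C) : Points g C :=
  ⟨x.1 ≫ π, by rw [Category.assoc, hπ, x.2]⟩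

/-- The value in `C` of a regular function on an open set containing the point. -/
def eval (x : Points f C) (U : X.Opens) (h : ⊤ ≤ x.1 ⁻¹ᵁ U) (s : Γ(X, U)) : C :=
  (Scheme.ΓSpecIso (.of C)).hom (x.1.appLE U ⊤ h s)

/-- The `C`-points of the support of a closed subscheme. -/
def ofSupport (f : X ⟶ Spec (.of F)) (I : X.IdealSheafData) (C : Type) [Field C] [Algebra F C] :
    Set (Points f C) :=
  {x | x.pt ∈ I.support}

/-- The topology of `X(C)` for a normed field `C`: the coarsest one for which `U(C)` is open and
every regular function on `U` is continuous on `U(C)`, for all Zariski open `U`. -/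
instance {C : Type} [NormedField C] [Algebra F C] : TopologicalSpace (Points f C) :=
  TopologicalSpace.generateFrom
    {S | ∃ (U : X.Opens) (s : Γ(X, U)) (W : Set C), IsOpen W ∧
      S = {x | ∃ h : ⊤ ≤ x.1 ⁻¹ᵁ U, x.eval U h s ∈ W}}

/-- The point of the base change `X_C` given by a `C`-point of `X`. -/
def geomPt (x : Points f C) :
    ↥(Limits.pullback f (Spec.map (CommRingCat.ofHom (algebraMap F C)))) :=
  (Limits.pullback.lift x.1 (𝟙 _) (by rw [x.2, Category.id_comp])) (IsLocalRing.closedPoint C)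

end Points

/-- A set of points of `X(C)` is Zariski dense if it is dense in the base change `X_C`. -/
def IsZariskiDense {f : X ⟶ Spec (.of F)} {C : Type} [Field C] [Algebra F C]
    (S : Set (Points f C)) : Prop :=
  Dense (Points.geomPt '' S)

end Points

/-! ### Projective space -/

section ProjectiveSpace

variable (F : Type) [Field F] (n : ℕ)

/-- The grading of `F[y_0, …, y_n]`. -/
abbrev grading : ℕ → Submodule F (MvPolynomial (Fin (n + 1)) F) :=
  MvPolynomial.homogeneousSubmodule (Fin (n + 1)) F

instance : GradedAlgebra (grading F n) := MvPolynomial.gradedAlgebra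

/-- Projective `n`-space over `F`. -/
abbrev PP : Scheme.{0} := Proj (grading F n)

/-- The structure morphism of projective space. -/
def PP.structureMorphism : PP F n ⟶ Spec (.of F) :=
  Proj.toSpecZero (grading F n) ≫
    Spec.map (CommRingCat.ofHom (algebraMap F (grading F n 0)))

variable {F n} in
lemma X_mem (i : Fin (n + 1)) : (MvPolynomial.X i : MvPolynomial (Fin (n + 1)) F) ∈ grading F n 1 :=
  MvPolynomial.isHomogeneous_X F i

/-- The affine coordinate `y_j / y_i` on the chart `y_i ≠ 0`. -/
def affineCoord (i j : Fin (n + 1)) :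
    HomogeneousLocalization.Away (grading F n) (MvPolynomial.X i) :=
  HomogeneousLocalization.Away.mk (grading F n) (X_mem i) 1 (MvPolynomial.X j) (X_mem j)

/-- The hyperplane `H = {y_0 = 0}`, as the ideal sheaf of a reduced closed subscheme. -/
def hyperplane : (PP F n).IdealSheafData :=
  Scheme.IdealSheafData.vanishingIdeal
    ⟨(Proj.basicOpen (grading F n) (MvPolynomial.X 0) : Set (PP F n))ᶜ,
      (Proj.basicOpen (grading F n) (MvPolynomial.X 0)).isOpen.isClosed_compl⟩

variable {F n}

/-- `a = (a_0, …, a_n)` are homogeneous coordinates of the point `x` of `ℙⁿ(C)`: for some `i` with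
`a_i ≠ 0`, the point `x` lies in the chart `y_i ≠ 0` and has affine coordinates `a_j / a_i`. -/
def IsHomogCoord {C : Type} [Field C] [Algebra F C] (x : Points (PP.structureMorphism F n) C)
    (a : Fin (n + 1) → C) : Prop :=
  ∃ i, a i ≠ 0 ∧ ∃ φ : HomogeneousLocalization.Away (grading F n) (MvPolynomial.X i) →+* C,
    (∀ j, φ (affineCoord F n i j) = a j / a i) ∧
      x.1 = Spec.map (CommRingCat.ofHom φ) ≫
        Proj.awayι (grading F n) (MvPolynomial.X i) (X_mem i) one_pos

/-- The projective distance `max |a_i b_j - a_j b_i| / (max |a_i| · max |b_j|)` of two points with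
homogeneous coordinates `a` and `b`. This is the standard metric of projective space in the
nonarchimedean case; over `ℂ` it agrees up to bounded factors with the chordal (Fubini–Study)
metric. -/
def projDist {C : Type} [NormedField C] (a b : Fin (n + 1) → C) : ℝ :=
  ‖fun p : Fin (n + 1) × Fin (n + 1) => a p.1 * b p.2 - a p.2 * b p.1‖ / (‖a‖ * ‖b‖)

/-- Two points of `ℙⁿ(C)`, for nonarchimedean `C`, have the same reduction in projective space over
the residue field: they have primitive homogeneous coordinates which are congruent modulo the
maximal ideal. -/
def SameReduction {C : Type} [NormedField C] [Algebra F C]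
    (x y : Points (PP.structureMorphism F n) C) : Prop :=
  ∃ a b : Fin (n + 1) → C, IsHomogCoord x a ∧ IsHomogCoord y b ∧ ‖a‖ = 1 ∧ ‖b‖ = 1 ∧
    ∀ j, ‖a j - b j‖ < 1

end ProjectiveSpace

/-! ### Divisors -/

section Divisors

variable {F : Type} [Field F] {X : Scheme.{0}}

/-- The closed subscheme defined by `D` is an effective Cartier divisor: locally its ideal is
generated by a nonzerodivisor. For effective Cartier divisors, the multiple `m D` is given by the
power `D ^ m` of the ideal sheaf. -/
def IsEffectiveCartier (D : X.IdealSheafData) : Prop :=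
  ∀ x : X, ∃ U : X.affineOpens, x ∈ U.1 ∧
    ∃ s ∈ nonZeroDivisors Γ(X, U.1), D.ideal U = Ideal.span {s}

/-- An effective Cartier divisor on a projective `F`-scheme is ample if a positive multiple of it is
very ample, i.e. is a hyperplane section in some projective embedding over `F`. -/
def IsAmple (f : X ⟶ Spec (.of F)) (D : X.IdealSheafData) : Prop :=
  ∃ (m n : ℕ) (j : X ⟶ PP F n), 0 < m ∧ IsClosedImmersion j ∧
    j ≫ PP.structureMorphism F n = f ∧ (hyperplane F n).comap j = D ^ m

/-- All local rings of `X` are integrally closed. -/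
def IsNormalScheme (X : Scheme.{0}) [IsIntegral X] : Prop :=
  ∀ x : X, IsIntegrallyClosed (X.presheaf.stalk x)

/-- The degree of the function field of `X` over that of `Y`, for a dominant morphism of integral
schemes. -/
def degree {X Y : Scheme.{0}} [IsIntegral X] (π : X ⟶ Y) : ℕ :=
  letI := (π.stalkMap (genericPoint X)).hom.toAlgebra
  Module.finrank (Y.presheaf.stalk (π (genericPoint X))) (X.presheaf.stalk (genericPoint X))

end Divisors

/-! ### Adelic sets and capacities -/

section Capacity

variable {F : Type} [Field F] {X : Scheme.{0}}

/-- A family `∏_v E_v` of subsets of the sets `X(ℂ_v)`. -/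
abbrev AdelicFamily (f : X ⟶ Spec (.of F)) : Type := (v : Place F) → Set (Points f v.Cv)

variable {f : X ⟶ Spec (.of F)} {t : ℕ}

/-- The standard hypotheses on `∏_v E_v` relative to the divisor `D`, with respect to the projective
embedding `i`. Since `F` is dense in `F_v`, a continuous automorphism of `ℂ_v` fixes `F_v` if and
only if it fixes `F`. -/
structure StandardHypotheses (i : X ⟶ PP F t) (hi : i ≫ PP.structureMorphism F t = f)
    (D : X.IdealSheafData) (E : AdelicFamily f) : Prop where
  disjoint_support : ∀ v, Disjoint (E v) (Points.ofSupport f D v.Cv)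
  nonempty : ∀ v, (E v).Nonempty
  galois_stable : ∀ (v : Place F) (σ : v.Cv ≃ₐ[F] v.Cv), Continuous σ → Continuous σ.symm →
    ∀ x ∈ E v, x.baseChange σ.toAlgHom ∈ E v
  bounded_away : ∀ v : Place F, ∃ ε > 0, ∀ x ∈ E v, ∀ y ∈ Points.ofSupport f D v.Cv,
    ∀ a b, IsHomogCoord (x.push i hi) a → IsHomogCoord (y.push i hi) b → ε ≤ projDist a b
  reduction_disjoint : {w : NonarchPlace F | ∃ x ∈ E (.nonarch w),
    ∃ y ∈ Points.ofSupport f D (Place.nonarch w).Cv,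
      SameReduction (x.push i hi) (y.push i hi)}.Finite

/-- The set `𝒰(E)` of open adelic neighborhoods of `E` which satisfy the standard hypotheses. -/
def openNeighborhoods (i : X ⟶ PP F t) (hi : i ≫ PP.structureMorphism F t = f)
    (D : X.IdealSheafData) (E : AdelicFamily f) : Set (AdelicFamily f) :=
  {U | StandardHypotheses i hi D U ∧ ∀ v, IsOpen (U v) ∧ E v ⊆ U v}

variable (F) in
/-- The set `ℛ` of functions `r : M(F) → [0, ∞)` with `r(v) = 1` for almost all `v`. -/
def Radii : Type := {r : Place F → ℝ // (∀ v, 0 ≤ r v) ∧ {v | r v ≠ 1}.Finite}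

/-- `|r| = ∏_v r(v)`. -/
def Radii.norm (r : Radii F) : ℝ := ∏ᶠ v, r.1 v

/-- The polydisk `B_v(ρ)` in `ℙᵈ(ℂ_v)`: the points with homogeneous coordinates
`(1 : z_1 : ⋯ : z_d)` such that `|z_i|_v ≤ ρ` for all `i`. -/
def polydisk (d : ℕ) (v : Place F) (ρ : ℝ) : Set (Points (PP.structureMorphism F d) v.Cv) :=
  {x | ∃ a : Fin (d + 1) → v.Cv, IsHomogCoord x a ∧ a 0 = 1 ∧ ∀ i : Fin d, v.nabs (a i.succ) ≤ ρ}

/-- `π : X → ℙᵈ` is a finite morphism over `F` such that `π⁻¹(H) = m D` as Cartier divisors, with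
`m > 0`. -/
structure IsFiniteMorphismWithPole (f : X ⟶ Spec (.of F)) (D : X.IdealSheafData) (d : ℕ)
    (π : X ⟶ PP F d) (m : ℕ) : Prop where
  finite : IsFinite π
  over_base : π ≫ PP.structureMorphism F d = f
  pos : 0 < m
  comap_hyperplane : (hyperplane F d).comap π = D ^ m

/-- The finite morphism capacity of an open adelic set `U`: the supremum of
`|r| ^ (d * deg π / m ^ (d + 1))` over all `π` and `r` such that `π⁻¹(B(r)) ⊆ U`
(and `0` if there are none). -/
def openCapacity [IsIntegral X] (f : X ⟶ Spec (.of F)) (D : X.IdealSheafData) (d : ℕ)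
    (U : AdelicFamily f) : ENNReal :=
  ⨆ (π : X ⟶ PP F d) (m : ℕ) (hπ : IsFiniteMorphismWithPole f D d π m) (r : Radii F)
    (_ : ∀ v, Points.push π hπ.over_base ⁻¹' polydisk d v (r.1 v) ⊆ U v),
    ENNReal.ofReal (r.norm ^ ((d * degree π : ℝ) / (m : ℝ) ^ (d + 1)))

/-- The finite morphism capacity `γ_F(E, D)`, the infimum of the capacities of the open
neighborhoods of `E`. -/
def capacity [IsIntegral X] (i : X ⟶ PP F t) (hi : i ≫ PP.structureMorphism F t = f)
    (D : X.IdealSheafData) (d : ℕ) (E : AdelicFamily f) : ENNReal :=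
  ⨅ U ∈ openNeighborhoods i hi D E, openCapacity f D d U

/-- The points of `X(F̄)` all of whose Galois conjugates lie in `U`: at every place `v`, the image of
the point in `X(ℂ_v)` under every embedding of `F̄` in `ℂ_v` over `F` lies in `U_v`. -/
def conjugatesIn (U : AdelicFamily f) : Set (Points f (AlgebraicClosure F)) :=
  {x | ∀ (v : Place F) (τ : AlgebraicClosure F →ₐ[F] v.Cv), x.baseChange τ ∈ U v}

end Capacity

end

end FiniteMorphismCapacity

/-! The capacity of `U` is at least that of `E`, so it exceeds 1. Since the exponent in its
definition is nonnegative, there are a finite π : X → ℙᵈ and radii r with |r| > 1 and π⁻¹(B(r)) ⊆ U.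
It therefore suffices to find many algebraic points of B(r) and pull them back.

By a Minkowski-type argument (`exists_small_element`) there are n > 0 and x ∈ F, x ≠ 0, with |x|_v ≤
r(v)^n at every place; passing to powers lets |r|^n outgrow all constants that depend only on F and
r. If y is an n-th root of x, then yζ has all its conjugates in the disks of radius r(v) for every
root of unity ζ, because ζ has absolute value 1 everywhere. So the set S of such numbers is infinite
(`infinite_conjugates_in_disks`).

Then S^d is Zariski dense in affine space. A finite morphism between varieties of the same dimension
d is dominant (`asHomogeneousIdeal_genericPoint_eq_bot`), so the preimage of S^d in X is dense too
(`exists_algHom_productMap_ne_zero`, `isZariskiDense_of_chart`). All conjugates of the points in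
that preimage lie in π⁻¹(B(r)).

The product formula is needed only as an inequality, ∏ |b|_w ≥ #(A/b)^(-N) for A = ℤ or 𝔽_p[t]
(`one_le_card_pow_mul_prod`), proved by counting residues. -/

namespace FiniteMorphismCapacity

noncomputable section

/-! ### Normalized nonarchimedean absolute values, their balls, and weak approximation. -/

namespace NonarchPlace

variable {F : Type} [Field F] (w : NonarchPlace F)

/-- The number of elements of the residue field. -/
def q : ℕ := Nat.card (valuationRing w.abv w.nonarch ⧸ maximalIdeal w.abv w.nonarch)

lemma exists_uniformizer : ∃ x : F, w.abv x = (w.q : ℝ)⁻¹ := w.normalized.1.2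

lemma q_inv_lt_one : (w.q : ℝ)⁻¹ < 1 := w.normalized.1.1

lemma le_q_inv {x : F} (hx : w.abv x < 1) : w.abv x ≤ (w.q : ℝ)⁻¹ :=
  w.normalized.2 ⟨hx, x, rfl⟩

lemma exists_abv_lt_one : ∃ x : F, x ≠ 0 ∧ w.abv x < 1 := by
  obtain ⟨x, hx0, hx1⟩ := w.nontrivial
  rcases lt_or_gt_of_ne hx1 with h | h
  · exact ⟨x, hx0, h⟩
  · exact ⟨x⁻¹, inv_ne_zero hx0, by rw [map_inv₀]; exact inv_lt_one_of_one_lt₀ h⟩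

lemma q_pos : 0 < (w.q : ℝ) := by
  obtain ⟨x, hx0, hx1⟩ := w.exists_abv_lt_one
  exact inv_pos.1 ((w.abv.pos hx0).trans_le (w.le_q_inv hx1))

lemma one_lt_q : 1 < (w.q : ℝ) := (inv_lt_one₀ w.q_pos).1 w.q_inv_lt_one

lemma two_le_q : 2 ≤ w.q := by exact_mod_cast w.one_lt_q

lemma q_ne_zero : (w.q : ℝ) ≠ 0 := w.q_pos.ne'

/-- A power of a uniformizer moves x into the range [1/q, 1), where 1/q is the only value taken. -/
lemma exists_abv_eq_zpow {x : F} (hx : x ≠ 0) : ∃ k : ℤ, w.abv x = (w.q : ℝ) ^ (-k) := by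
  obtain ⟨k, hk1, hk2⟩ := exists_mem_Ico_zpow (w.abv.pos hx) w.one_lt_q
  obtain ⟨p, hp⟩ := w.exists_uniformizer
  refine ⟨-k, ?_⟩
  have hv : w.abv (x * p ^ (k + 1)) = w.abv x * (w.q : ℝ) ^ (-(k + 1)) := by
    rw [map_mul, map_zpow₀, hp, inv_zpow, zpow_neg]
  have h1 : w.abv (x * p ^ (k + 1)) < 1 := by
    rw [hv, zpow_neg, ← div_eq_mul_inv, div_lt_one (zpow_pos w.q_pos _)]
    exact hk2
  have h2 := w.le_q_inv h1
  rw [hv, zpow_neg, ← div_eq_mul_inv, div_le_iff₀ (zpow_pos w.q_pos _), zpow_add_one₀ w.q_ne_zero,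
    mul_comm, mul_assoc, mul_inv_cancel₀ w.q_ne_zero, mul_one] at h2
  rw [neg_neg]
  exact le_antisymm h2 hk1

/-- Rounding a radius down to a power of q loses at most a factor q. Later this loss occurs once for
each place of a finite set, independently of the exponent n. -/
lemma exists_zpow_le_lt {ρ : ℝ} (hρ : 0 < ρ) :
    ∃ k : ℤ, (w.q : ℝ) ^ (-k) ≤ ρ ∧ (w.q : ℝ) ^ k ≤ w.q / ρ := by
  obtain ⟨k, hk1, hk2⟩ := exists_mem_Ico_zpow hρ w.one_lt_q
  refine ⟨-k, by rwa [neg_neg], ?_⟩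
  rw [le_div_iff₀ hρ, zpow_neg, inv_mul_le_iff₀ (zpow_pos w.q_pos _), ← zpow_add_one₀ w.q_ne_zero]
  exact hk2.le

/-- The fractional ideal `{x | |x| ≤ q ^ (-k)}`. -/
def ball (k : ℤ) : AddSubgroup F where
  carrier := {x | w.abv x ≤ (w.q : ℝ) ^ (-k)}
  zero_mem' := by
    change w.abv 0 ≤ _
    rw [map_zero]
    exact (zpow_pos w.q_pos _).le
  add_mem' {a b} ha hb := (w.nonarch a b).trans (max_le ha hb)
  neg_mem' {a} ha := by
    change w.abv (-a) ≤ _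
    rwa [map_neg_eq_map]

lemma mem_ball {k : ℤ} {x : F} : x ∈ w.ball k ↔ w.abv x ≤ (w.q : ℝ) ^ (-k) := Iff.rfl

lemma mem_ball_zero {x : F} : x ∈ w.ball 0 ↔ w.abv x ≤ 1 := by simp [mem_ball]

lemma ball_anti {k l : ℤ} (h : k ≤ l) : w.ball l ≤ w.ball k := fun _ hx =>
  hx.trans (zpow_le_zpow_right₀ w.one_lt_q.le (neg_le_neg h))

lemma mem_ball_succ {k : ℤ} {x : F} : x ∈ w.ball (k + 1) ↔ w.abv x < (w.q : ℝ) ^ (-k) := by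
  rw [mem_ball]
  constructor
  · exact fun h => h.trans_lt (zpow_lt_zpow_right₀ w.one_lt_q (by lia))
  · intro h
    rcases eq_or_ne x 0 with rfl | hx
    · rw [map_zero]; exact (zpow_pos w.q_pos _).le
    · obtain ⟨l, hl⟩ := w.exists_abv_eq_zpow hx
      rw [hl] at h ⊢
      rw [zpow_lt_zpow_iff_right₀ w.one_lt_q] at h
      exact zpow_le_zpow_right₀ w.one_lt_q.le (by lia)

lemma relIndex_ball_one : (w.ball 1).relIndex (w.ball 0) = w.q := by
  let e : (valuationRing w.abv w.nonarch) ≃+ w.ball 0 :=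
    { toFun := fun x => ⟨x.1, w.mem_ball_zero.2 x.2⟩
      invFun := fun x => ⟨x.1, w.mem_ball_zero.1 x.2⟩
      left_inv := fun _ => rfl
      right_inv := fun _ => rfl
      map_add' := fun _ _ => rfl }
  have h : (maximalIdeal w.abv w.nonarch).toAddSubgroup.map e.toAddMonoidHom =
      (w.ball 1).addSubgroupOf (w.ball 0) := by
    ext x
    rw [AddSubgroup.mem_map_equiv, AddSubgroup.mem_addSubgroupOf]
    have := w.mem_ball_succ (k := 0) (x := x.1)
    simp only [zero_add, neg_zero, zpow_zero] at this
    rw [this]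
    rfl
  rw [AddSubgroup.relIndex, AddSubgroup.index, q]
  exact Nat.card_congr (QuotientAddGroup.congr _ _ e h).symm.toEquiv

/-- Multiplication by the k-th power of a uniformizer carries the case k = 0, the residue field, to
the general one. -/
lemma relIndex_ball_succ (k : ℤ) : (w.ball (k + 1)).relIndex (w.ball k) = w.q := by
  obtain ⟨p, hp⟩ := w.exists_uniformizer
  have hp0 : p ≠ 0 := by
    rintro rfl
    rw [map_zero] at hp
    exact w.q_ne_zero (inv_eq_zero.1 hp.symm)
  have hmap (l : ℤ) : (w.ball l).map (AddMonoidHom.mulLeft (p ^ k)) = w.ball (l + k) := by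
    have hpk : p ^ k ≠ 0 := zpow_ne_zero k hp0
    have hv : w.abv (p ^ k) = (w.q : ℝ) ^ (-k) := by rw [map_zpow₀, hp, inv_zpow, zpow_neg]
    ext x
    rw [AddSubgroup.mem_map, mem_ball]
    constructor
    · rintro ⟨y, hy, rfl⟩
      rw [AddMonoidHom.coe_mulLeft, map_mul, hv, neg_add, zpow_add₀ w.q_ne_zero, mul_comm]
      exact mul_le_mul_of_nonneg_right hy (zpow_pos w.q_pos _).le
    · intro hx
      refine ⟨(p ^ k)⁻¹ * x, ?_, by rw [AddMonoidHom.coe_mulLeft, mul_inv_cancel_left₀ hpk]⟩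
      rw [neg_add, zpow_add₀ w.q_ne_zero] at hx
      rwa [mem_ball, map_mul, map_inv₀, hv, inv_mul_le_iff₀ (zpow_pos w.q_pos _), mul_comm]
  have h := AddSubgroup.relIndex_map_map_of_injective (w.ball 1) (w.ball 0)
    (f := AddMonoidHom.mulLeft (p ^ k)) (mul_right_injective₀ (zpow_ne_zero k hp0))
  rw [hmap, hmap, w.relIndex_ball_one, zero_add, add_comm] at h
  exact h

lemma relIndex_ball_add (k : ℤ) (n : ℕ) : (w.ball (k + n)).relIndex (w.ball k) = w.q ^ n := by
  induction n with
  | zero => simp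
  | succ n ih =>
    have h := AddSubgroup.relIndex_mul_relIndex (w.ball (k + n + 1)) (w.ball (k + n)) (w.ball k)
      (w.ball_anti (by lia)) (w.ball_anti (by lia))
    rw [relIndex_ball_succ, ih] at h
    rw [Nat.cast_succ, ← add_assoc, ← h, pow_succ']

variable {w} in
-- Equivalent absolute values have the same integers and the same maximal ideal, hence the same q
-- and the same uniformizers, and the normalization fixes the value there. Thus distinct places are
-- inequivalent, as weak approximation requires.
lemma eq_of_isEquiv {w' : NonarchPlace F} (h : w.abv.IsEquiv w'.abv) : w = w' := by
  have hr : (valuationRing w.abv w.nonarch) = valuationRing w'.abv w'.nonarch := by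
    ext x
    exact h.le_one_iff
  have hq : w.q = w'.q := by
    rw [← relIndex_ball_one, ← relIndex_ball_one]
    have h0 : w.ball 0 = w'.ball 0 := by
      ext x
      rw [mem_ball_zero, mem_ball_zero, h.le_one_iff]
    have h1 : w.ball 1 = w'.ball 1 := by
      ext x
      have e := w.mem_ball_succ (k := 0) (x := x)
      have e' := w'.mem_ball_succ (k := 0) (x := x)
      simp only [zero_add, neg_zero, zpow_zero] at e e'
      rw [e, e', h.lt_one_iff]
    rw [h0, h1]
  have habv : w.abv = w'.abv := by
    ext x
    rcases eq_or_ne x 0 with rfl | hx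
    · simp
    obtain ⟨p, hp⟩ := w.exists_uniformizer
    obtain ⟨p', hp'⟩ := w'.exists_uniformizer
    have hpp : w'.abv p = (w'.q : ℝ)⁻¹ := by
      refine le_antisymm (w'.le_q_inv (h.lt_one_iff.1 (hp ▸ w.q_inv_lt_one))) ?_
      rw [← hp', ← h.le_iff_le, hp]
      exact w.le_q_inv (h.lt_one_iff.2 (hp' ▸ w'.q_inv_lt_one))
    obtain ⟨k, hk⟩ := w.exists_abv_eq_zpow hx
    have h1 : w.abv x = w.abv (p ^ k) := by rw [hk, map_zpow₀, hp, inv_zpow, zpow_neg]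
    rw [h1, h.eq_iff_eq.1 h1, map_zpow₀, map_zpow₀, hp, hpp, hq]
  cases w
  cases w'
  cases habv
  rfl

/-- Weak approximation for finitely many nonarchimedean places. -/
lemma exists_sub_mem_ball (T : Finset (NonarchPlace F)) (y : NonarchPlace F → F)
    (k : NonarchPlace F → ℤ) : ∃ x : F, ∀ w ∈ T, x - y w ∈ w.ball (k w) := by
  have hd := AbsoluteValue.denseRange_algebraMap_pi (v := fun w : T => w.1.abv)
    (fun w => w.1.nontrivial) (fun w w' hne he => hne (Subtype.ext (eq_of_isEquiv he)))
  -- Every factor is at most 1, so the product is below each of the required radii.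
  let ε : ℝ := ∏ w ∈ T, min 1 ((w.q : ℝ) ^ (-k w))
  have hpos (w : NonarchPlace F) : 0 < min 1 ((w.q : ℝ) ^ (-k w)) :=
    lt_min one_pos (zpow_pos w.q_pos _)
  have hε : 0 < ε := Finset.prod_pos fun w _ => hpos w
  obtain ⟨x, hx⟩ := Metric.denseRange_iff.1 hd (fun w => WithAbs.toAbs w.1.abv (y w.1)) ε hε
  refine ⟨x, fun w hw => ?_⟩
  have h1 := (dist_le_pi_dist _ _ (⟨w, hw⟩ : T)).trans hx.le
  rw [mem_ball, ← map_neg_eq_map]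
  have h2 : ε ≤ (w.q : ℝ) ^ (-k w) := by
    classical
    refine le_trans ?_ (min_le_right 1 _)
    change ∏ w ∈ T, min 1 ((w.q : ℝ) ^ (-k w)) ≤ _
    rw [← Finset.prod_erase_mul _ _ hw]
    exact mul_le_of_le_one_left (hpos w).le
      (Finset.prod_le_one (fun i _ => (hpos i).le) fun i _ => min_le_left _ _)
  refine le_trans (le_of_eq ?_) (h1.trans h2)
  rw [dist_eq_norm]
  rw [neg_sub]
  rfl

end NonarchPlace

/-! ### Lower bound for products of absolute values; integrality and index estimates. -/

namespace NonarchPlace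

variable {F : Type} [Field F]

lemma exists_injective_reps (w : NonarchPlace F) (n : ℕ) :
    ∃ s : Fin (w.q ^ n) → F, (∀ i, s i ∈ w.ball 0) ∧
      ∀ i j, s i - s j ∈ w.ball n → i = j := by
  have h := w.relIndex_ball_add 0 n
  rw [zero_add, AddSubgroup.relIndex, AddSubgroup.index] at h
  have hpos : w.q ^ n ≠ 0 := pow_ne_zero _ (by have := w.two_le_q; lia)
  have : Finite (w.ball 0 ⧸ (w.ball n).addSubgroupOf (w.ball 0)) :=
    Nat.finite_of_card_ne_zero (h ▸ hpos)
  let e := (Finite.equivFinOfCardEq h).symm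
  refine ⟨fun i => (Quotient.out (e i)).1, fun i => (Quotient.out (e i)).2, fun i j hij => ?_⟩
  apply e.injective
  rw [← QuotientAddGroup.out_eq' (e i), ← QuotientAddGroup.out_eq' (e j)]
  refine ((QuotientAddGroup.eq_iff_sub_mem).2 ?_)
  rw [AddSubgroup.mem_addSubgroupOf]
  exact hij

/-- The product of the absolute values of `b` at finitely many places at which `A` is integral is
bounded below by the index of `b` in a free module whose rank is the maximal number of
`A`-independent elements of `F`. -/
lemma prod_pow_le_card_quotient {A : Type} [CommRing A] [IsDomain A] [IsPrincipalIdealRing A]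
    [Algebra A F] [FaithfulSMul A F] (N : ℕ)
    (hN : ∀ (m : ℕ) (s : Fin m → F), LinearIndependent A s → m ≤ N)
    (b : A) [Finite (A ⧸ Ideal.span {b})] (T : Finset (NonarchPlace F))
    (hT : ∀ w ∈ T, ∀ a : A, w.abv (algebraMap A F a) ≤ 1)
    (k : NonarchPlace F → ℕ)
    (hk : ∀ w ∈ T, w.abv (algebraMap A F b) ≤ (w.q : ℝ) ^ (-(k w : ℤ))) :
    ∏ w ∈ T, w.q ^ k w ≤ Nat.card (A ⧸ Ideal.span {b}) ^ N := by
  choose s hs0 hs using fun w : NonarchPlace F => w.exists_injective_reps (k w)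
  let ι := (w : T) → Fin (w.1.q ^ k w.1)
  -- Weak approximation realizes each tuple of residue classes by a single element of F, integral at
  -- all places of T.
  have hx (c : ι) : ∃ x : F, ∀ w : T, x - s w.1 (c w) ∈ w.1.ball (k w.1) := by
    classical
    obtain ⟨x, hx⟩ := exists_sub_mem_ball T
      (fun w => if h : w ∈ T then s w (c ⟨w, h⟩) else 0) (fun w => k w)
    exact ⟨x, fun w => by simpa [w.2] using hx w.1 w.2⟩
  choose x hx using hx
  have hx0 (c : ι) (w : T) : x c ∈ w.1.ball 0 := by
    have := add_mem (w.1.ball_anti (by lia) (hx c w)) (hs0 w.1 (c w))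
    rwa [sub_add_cancel] at this
  -- M is finitely generated and torsion-free over a principal ideal domain, hence free, and its
  -- elements remain integral at T because those of A are.
  let M : Submodule A F := Submodule.span A (Set.range x)
  have hM : ∀ y ∈ M, ∀ w : T, y ∈ w.1.ball 0 := by
    intro y hy w
    induction hy using Submodule.span_induction with
    | mem y hy =>
      obtain ⟨c, rfl⟩ := hy
      exact hx0 c w
    | zero => exact zero_mem _
    | add y z _ _ hy hz => exact add_mem hy hz
    | smul a y _ hy =>
      rw [mem_ball_zero] at hy ⊢
      rw [Algebra.smul_def, map_mul]
      exact mul_le_one₀ (hT w.1 w.2 a) (w.1.abv.nonneg _) hy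
  have : Module.Finite A M := Module.Finite.span_of_finite A (Set.finite_range x)
  have : Module.IsTorsionFree A F := inferInstance
  have : Module.Free A M := inferInstance
  let bs := Module.finBasis A M
  have hr : Module.finrank A M ≤ N := by
    refine hN _ (fun i => (bs i : F)) ?_
    exact bs.linearIndependent.map' M.subtype (Submodule.ker_subtype M)
  -- Coordinates modulo b separate the tuples: if they agree, then x c - x c' lies in bM, so it is
  -- small at every place of T and the residue classes coincide.
  let g : ι → Fin (Module.finrank A M) → A ⧸ Ideal.span {b} := fun c i =>
    Ideal.Quotient.mk _ (bs.repr ⟨x c, Submodule.subset_span ⟨c, rfl⟩⟩ i)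
  have hg : Function.Injective g := by
    intro c c' hcc
    have hdvd : ∀ i, ∃ e : A, bs.repr (⟨x c, Submodule.subset_span ⟨c, rfl⟩⟩ -
        ⟨x c', Submodule.subset_span ⟨c', rfl⟩⟩) i = b * e := by
      intro i
      have := Ideal.Quotient.eq.1 (congrFun hcc i)
      rw [Ideal.mem_span_singleton] at this
      obtain ⟨e, he⟩ := this
      exact ⟨e, by rw [map_sub, Finsupp.sub_apply, he]⟩
    choose e he using hdvd
    have hsub : x c - x c' = algebraMap A F b * ((∑ i, e i • bs i : M) : F) := by
      have h1 := bs.sum_repr (⟨x c, Submodule.subset_span ⟨c, rfl⟩⟩ -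
        ⟨x c', Submodule.subset_span ⟨c', rfl⟩⟩)
      simp only [he, mul_smul, ← Finset.smul_sum] at h1
      have h2 := congrArg (fun y : M => (y : F)) h1
      simp only [Submodule.coe_smul, Submodule.coe_sub] at h2
      rw [← h2, Algebra.smul_def]
    funext w
    apply hs w.1
    have h3 : x c - x c' ∈ w.1.ball (k w.1) := by
      rw [hsub, mem_ball, map_mul]
      exact (mul_le_of_le_one_right (w.1.abv.nonneg _)
        (w.1.mem_ball_zero.1 (hM _ (Subtype.property _) w))).trans (hk w.1 w.2)
    have h4 := add_mem (sub_mem h3 (hx c w)) (hx c' w)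
    convert h4 using 1
    ring
  have hcard := Nat.card_le_card_of_injective g hg
  rw [Nat.card_fun, Nat.card_fin] at hcard
  calc ∏ w ∈ T, w.q ^ k w = Nat.card ι := by
        rw [Nat.card_pi, ← Finset.prod_coe_sort]
        simp
    _ ≤ _ := hcard
    _ ≤ _ := Nat.pow_le_pow_right Nat.card_pos hr

/-- A version of `prod_pow_le_card_quotient` for absolute values. -/
lemma one_le_card_pow_mul_prod {A : Type} [CommRing A] [IsDomain A] [IsPrincipalIdealRing A]
    [Algebra A F] [FaithfulSMul A F] (N : ℕ)
    (hN : ∀ (m : ℕ) (s : Fin m → F), LinearIndependent A s → m ≤ N)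
    {b : A} (hb : b ≠ 0) [Finite (A ⧸ Ideal.span {b})] (T : Finset (NonarchPlace F))
    (hT : ∀ w ∈ T, ∀ a : A, w.abv (algebraMap A F a) ≤ 1) :
    1 ≤ (Nat.card (A ⧸ Ideal.span {b}) : ℝ) ^ N * ∏ w ∈ T, w.abv (algebraMap A F b) := by
  have hb' : algebraMap A F b ≠ 0 := by
    rwa [Ne, FaithfulSMul.algebraMap_eq_zero_iff]
  have hk (w : NonarchPlace F) : ∃ k : ℕ, w ∈ T →
      w.abv (algebraMap A F b) = (w.q : ℝ) ^ (-(k : ℤ)) := by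
    by_cases hw : w ∈ T
    · obtain ⟨k, hk⟩ := w.exists_abv_eq_zpow hb'
      have h1 := hT w hw b
      rw [hk, zpow_le_one_iff_right₀ w.one_lt_q] at h1
      lift k to ℕ using by lia
      exact ⟨k, fun _ => hk⟩
    · exact ⟨0, fun h => absurd h hw⟩
  choose k hk using hk
  have h := prod_pow_le_card_quotient N hN b T hT k (fun w hw => (hk w hw).le)
  rw [Finset.prod_congr rfl hk]
  simp only [zpow_neg, zpow_natCast]
  rw [Finset.prod_inv_distrib, ← div_eq_mul_inv, one_le_div]
  · exact_mod_cast h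
  · exact Finset.prod_pos fun w _ => pow_pos w.q_pos _

/-- Only finitely many places divide `b`. -/
lemma finite_setOf_abv_lt_one {A : Type} [CommRing A] [IsDomain A] [IsPrincipalIdealRing A]
    [Algebra A F] [FaithfulSMul A F] (N : ℕ)
    (hN : ∀ (m : ℕ) (s : Fin m → F), LinearIndependent A s → m ≤ N)
    {b : A} (hb : b ≠ 0) [Finite (A ⧸ Ideal.span {b})] :
    {w : NonarchPlace F | (∀ a : A, w.abv (algebraMap A F a) ≤ 1) ∧
      w.abv (algebraMap A F b) < 1}.Finite := by
  by_contra hinf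
  -- With m = #(A/b)^N places, each contributing a factor at most 1/2, the lower bound would give 1
  -- ≤ m / 2^m.
  obtain ⟨T, hT, hcard⟩ := Set.Infinite.exists_subset_card_eq hinf
    (Nat.card (A ⧸ Ideal.span {b}) ^ N)
  have h := one_le_card_pow_mul_prod N hN hb T (fun w hw => (hT hw).1)
  have h2 : ∏ w ∈ T, w.abv (algebraMap A F b) ≤ ∏ w ∈ T, (2 : ℝ)⁻¹ := by
    refine Finset.prod_le_prod (fun w _ => w.abv.nonneg _) fun w hw => ?_
    refine (w.le_q_inv (hT hw).2).trans ?_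
    exact inv_anti₀ two_pos (by exact_mod_cast w.two_le_q)
  rw [Finset.prod_const, hcard] at h2
  set m := Nat.card (A ⧸ Ideal.span {b}) ^ N
  have h3 : (m : ℝ) < 2 ^ m := by exact_mod_cast Nat.lt_two_pow_self
  have h4 : (1 : ℝ) ≤ m * (2⁻¹) ^ m := by
    refine h.trans ?_
    rw [show ((Nat.card (A ⧸ Ideal.span {b}) : ℝ) ^ N) = (m : ℝ) by simp [m]]
    exact mul_le_mul_of_nonneg_left h2 (by positivity)
  rw [inv_pow, ← div_eq_mul_inv, one_le_div (by positivity)] at h4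
  linarith

lemma abv_aeval_le_one {A : Type} [CommRing A] [Algebra A F] (w : NonarchPlace F)
    (hw : ∀ a : A, w.abv (algebraMap A F a) ≤ 1) {x : F} (hx : w.abv x ≤ 1) (p : Polynomial A) :
    w.abv (Polynomial.aeval x p) ≤ 1 := by
  change Polynomial.aeval x p ∈ valuationRing w.abv w.nonarch
  induction p using Polynomial.induction_on' with
  | add r s hr hs => rw [map_add]; exact add_mem hr hs
  | monomial n a =>
    rw [Polynomial.aeval_monomial]
    exact mul_mem (hw a) (pow_mem (show w.abv x ≤ 1 from hx) n)

/-- If `F` is algebraic over `A`, then no place is trivial on `A`. -/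
lemma exists_algebraMap_abv_lt_one {A : Type} [CommRing A] [Algebra A F]
    [FaithfulSMul A F] [Algebra.IsAlgebraic A F] (w : NonarchPlace F)
    (hw : ∀ a : A, w.abv (algebraMap A F a) ≤ 1) :
    ∃ b : A, b ≠ 0 ∧ w.abv (algebraMap A F b) < 1 := by
  obtain ⟨x, hx0, hx1⟩ := w.exists_abv_lt_one
  obtain ⟨p, hp0, hp⟩ := (Algebra.IsAlgebraic.isAlgebraic (R := A) x
    ).exists_nonzero_coeff_and_aeval_eq_zero (mem_nonZeroDivisors_of_ne_zero hx0)
  refine ⟨p.coeff 0, hp0, ?_⟩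
  -- The relation p(x) = 0 writes the nonzero constant term as x times an integral element.
  have h := congrArg (Polynomial.aeval x) (Polynomial.divX_mul_X_add p)
  rw [hp, map_add, map_mul, Polynomial.aeval_X, Polynomial.aeval_C] at h
  have h1 : algebraMap A F (p.coeff 0) = -(Polynomial.aeval x p.divX * x) := by linear_combination h
  rw [h1, map_neg_eq_map, map_mul]
  have h2 := w.abv_aeval_le_one hw hx1.le p.divX
  exact (mul_le_of_le_one_left (w.abv.nonneg _) h2).trans_lt hx1

/-- The reverse of a monic equation for x has constant term 1 and root 1/x. If |x| > 1, it would
express 1 as an integral multiple of 1/x. -/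
lemma abv_le_one_of_isIntegral {A : Type} [CommRing A] [Algebra A F] (w : NonarchPlace F)
    (hw : ∀ a : A, w.abv (algebraMap A F a) ≤ 1) {x : F} (hx : IsIntegral A x) :
    w.abv x ≤ 1 := by
  by_contra! h
  have hx0 : x ≠ 0 := by
    rintro rfl
    rw [map_zero] at h
    exact absurd h (by norm_num)
  have hy : w.abv x⁻¹ < 1 := by rw [map_inv₀]; exact inv_lt_one_of_one_lt₀ h
  obtain ⟨p, hp, hpx⟩ := hx
  let := invertibleOfNonzero hx0
  have h1 : Polynomial.aeval x⁻¹ p.reverse = 0 := by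
    rw [← invOf_eq_inv, Polynomial.aeval_def, Polynomial.eval₂_reverse_eq_zero_iff]
    exact hpx
  have h2 := congrArg (Polynomial.aeval x⁻¹) (Polynomial.divX_mul_X_add p.reverse)
  rw [h1, map_add, map_mul, Polynomial.aeval_X, Polynomial.aeval_C, Polynomial.coeff_zero_reverse,
    hp.leadingCoeff, map_one] at h2
  have h3 : (1 : F) = -(Polynomial.aeval x⁻¹ p.reverse.divX * x⁻¹) := by linear_combination h2
  have h4 := congrArg w.abv h3
  rw [map_one, map_neg_eq_map, map_mul] at h4
  have h5 := (mul_le_of_le_one_left (w.abv.nonneg x⁻¹)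
    (w.abv_aeval_le_one hw hy.le p.reverse.divX)).trans_lt hy
  linarith

/-- There is `b ≠ 0` in `A` which is arbitrarily small at finitely many places. -/
lemma exists_mul_abv_le_one {A : Type} [CommRing A] [IsDomain A] [Algebra A F]
    [FaithfulSMul A F] [Algebra.IsAlgebraic A F] (T : Finset (NonarchPlace F))
    (hT : ∀ w ∈ T, ∀ a : A, w.abv (algebraMap A F a) ≤ 1) (r : NonarchPlace F → ℝ)
    (hr : ∀ w, 0 < r w) :
    ∃ b : A, b ≠ 0 ∧ ∀ w ∈ T, r w * w.abv (algebraMap A F b) ≤ 1 := by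
  classical
  induction T using Finset.induction_on with
  | empty => exact ⟨1, one_ne_zero, by simp⟩
  | insert w T hwT ih =>
    obtain ⟨b, hb0, hb⟩ := ih fun w' hw' => hT w' (Finset.mem_insert_of_mem hw')
    have hw := hT w (Finset.mem_insert_self w T)
    obtain ⟨c, hc0, hc⟩ := w.exists_algebraMap_abv_lt_one hw
    obtain ⟨n, hn⟩ := exists_pow_lt_of_lt_one (inv_pos.2 (hr w)) hc
    refine ⟨b * c ^ n, mul_ne_zero hb0 (pow_ne_zero n hc0), fun w' hw' => ?_⟩
    rw [map_mul, map_mul, map_pow, map_pow]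
    rcases Finset.mem_insert.1 hw' with rfl | h
    · have h1 : r w' * w'.abv (algebraMap A F c) ^ n ≤ 1 := by
        rw [← mul_inv_cancel₀ (hr w').ne']
        exact mul_le_mul_of_nonneg_left hn.le (hr w').le
      calc _ = w'.abv (algebraMap A F b) * (r w' * w'.abv (algebraMap A F c) ^ n) := by ring
        _ ≤ 1 := mul_le_one₀ (hw b) (mul_nonneg (hr w').le (pow_nonneg (w'.abv.nonneg _) _)) h1
    · rw [← mul_assoc]
      exact mul_le_one₀ (hb w' h) (pow_nonneg (w'.abv.nonneg _) _)
        (pow_le_one₀ (w'.abv.nonneg _) (hT w' hw' c))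

/-- The index of an intersection is at most the product of the indices, and restricting to a
subgroup L can only lower them. This bounds the number of congruence conditions needed to make
elements of L small at T. -/
lemma relIndex_iInf_ball_le (T : Finset (NonarchPlace F)) (l k : NonarchPlace F → ℤ)
    (hlk : ∀ w ∈ T, l w ≤ k w) (L : AddSubgroup F) (hL : ∀ w ∈ T, L ≤ w.ball (l w)) :
    (⨅ w : T, w.1.ball (k w)).relIndex L ≠ 0 ∧
      (((⨅ w : T, w.1.ball (k w)).relIndex L : ℕ) : ℝ) ≤ ∏ w ∈ T, (w.q : ℝ) ^ (k w - l w) := by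
  have hw (w : T) : (w.1.ball (k w)).relIndex (w.1.ball (l w)) =
      w.1.q ^ (k w - l w).toNat := by
    have := w.1.relIndex_ball_add (l w) (k w - l w).toNat
    rwa [Int.toNat_of_nonneg (by have := hlk w.1 w.2; lia), add_sub_cancel] at this
  have hne (w : T) : (w.1.ball (k w)).relIndex (w.1.ball (l w)) ≠ 0 := by
    rw [hw]
    exact pow_ne_zero _ (by have := w.1.two_le_q; lia)
  refine ⟨AddSubgroup.relIndex_iInf_ne_zero fun w => fun h =>
    hne w (AddSubgroup.relIndex_eq_zero_of_le_right (hL w.1 w.2) h), ?_⟩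
  calc (((⨅ w : T, w.1.ball (k w)).relIndex L : ℕ) : ℝ)
      ≤ ((∏ w : T, (w.1.ball (k w)).relIndex L : ℕ) : ℝ) := by
        exact_mod_cast AddSubgroup.relIndex_iInf_le _
    _ ≤ ((∏ w : T, w.1.q ^ (k w - l w).toNat : ℕ) : ℝ) := by
        exact_mod_cast Finset.prod_le_prod' fun w _ => (hw w) ▸
          AddSubgroup.relIndex_le_of_le_right (hL w.1 w.2) (hne w)
    _ = _ := by
        rw [← Finset.prod_coe_sort T fun w => (w.q : ℝ) ^ (k w - l w)]
        push_cast
        refine Finset.prod_congr rfl fun w _ => ?_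
        rw [← zpow_natCast, Int.toNat_of_nonneg (by have := hlk w.1 w.2; lia)]

end NonarchPlace

/-! ### Small elements of number fields by Minkowski's theorem. -/

section NumberField

open NumberField NumberField.mixedEmbedding MeasureTheory NumberField.InfinitePlace

variable (F : Type) [Field F] [NumberField F]

-- The covolume of the lattice J is its norm times the covolume of the integers, so Minkowski's
-- convex body theorem applies with a constant depending on F alone. The powers of 2 and π in the
-- volume of the box have product at least 1 and can be dropped.
open scoped Classical in
lemma exists_minkowski_constant : ∃ C : ℝ, 0 < C ∧ ∀ (J : Ideal (𝓞 F)), J ≠ ⊥ →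
    ∀ f : InfinitePlace F → ℝ, (∀ w, 0 < f w) →
    (Ideal.absNorm J : ℝ) * C < ∏ w, f w ^ w.mult →
    ∃ a ∈ J, a ≠ 0 ∧ ∀ w : InfinitePlace F, w (a : F) < f w := by
  let C0 : ENNReal := volume (ZSpan.fundamentalDomain (latticeBasis F)) *
    2 ^ (Module.finrank ℝ (mixedSpace F))
  have hC0 : C0 ≠ ⊤ := ENNReal.mul_ne_top
    (ZSpan.fundamentalDomain_isBounded _).measure_lt_top.ne (ENNReal.pow_ne_top (by simp))
  refine ⟨C0.toReal + 1, by positivity, fun J hJ f hf h => ?_⟩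
  let I : (FractionalIdeal (nonZeroDivisors (𝓞 F)) F)ˣ :=
    FractionalIdeal.mk0 F ⟨J, mem_nonZeroDivisors_of_ne_zero hJ⟩
  have hI : FractionalIdeal.absNorm I.1 = Ideal.absNorm J := by
    rw [FractionalIdeal.coe_mk0, FractionalIdeal.coeIdeal_absNorm]
  have hb : minkowskiBound F I = ENNReal.ofReal (Ideal.absNorm J) * C0 := by
    rw [minkowskiBound, volume_fundamentalDomain_fractionalIdealLatticeBasis, hI, mul_assoc]
    simp [C0]
  have hlt : minkowskiBound F I < volume (convexBodyLT F fun w => (f w).toNNReal) := by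
    rw [hb, convexBodyLT_volume]
    have h1 : ENNReal.ofReal (Ideal.absNorm J) * C0 ≤
        ENNReal.ofReal ((Ideal.absNorm J : ℝ) * (C0.toReal + 1)) := by
      rw [ENNReal.ofReal_mul (Nat.cast_nonneg _)]
      gcongr
      rw [← ENNReal.ofReal_toReal hC0]
      exact ENNReal.ofReal_le_ofReal (by simp)
    have h2 : ENNReal.ofReal (∏ w, f w ^ w.mult) =
        ((∏ w, (f w).toNNReal ^ w.mult : NNReal) : ENNReal) := by
      rw [← ENNReal.ofReal_coe_nnreal]
      congr 1
      push_cast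
      exact Finset.prod_congr rfl fun w _ => by rw [Real.coe_toNNReal _ (hf w).le]
    refine h1.trans_lt (((ENNReal.ofReal_lt_ofReal_iff_of_nonneg (by positivity)).2 h).trans_le ?_)
    rw [h2, ENNReal.ofNNReal_finsetProd]
    simp only [ENNReal.coe_pow]
    refine le_mul_of_one_le_left zero_le ?_
    exact_mod_cast one_le_convexBodyLTFactor F
  obtain ⟨a, ha, ha0, hlt⟩ := exists_ne_zero_mem_ideal_lt F I hlt
  rw [FractionalIdeal.coe_mk0] at ha
  obtain ⟨a', ha', rfl⟩ := (FractionalIdeal.mem_coeIdeal _).1 ha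
  exact ⟨a', ha', fun h => ha0 (by rw [h, map_zero]), fun w => by
    simpa [Real.coe_toNNReal _ (hf w).le] using hlt w⟩

variable {F}

lemma linearIndependent_int_le (m : ℕ) (s : Fin m → F) (h : LinearIndependent ℤ s) :
    m ≤ Module.finrank ℚ F := by
  have := ((LinearIndependent.iff_fractionRing ℤ ℚ).1 h).fintype_card_le_finrank
  simpa using this

/-- The element has the form x = a / b^n. A fixed integer b makes r(w)|b|_w ≤ 1 on the relevant
places, so the finite conditions on a define an ideal of norm at most constant / (∏ r(w)|b|_w)^n.
Minkowski's theorem supplies a once (∏ R · ∏ r)^n exceeds a constant. -/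
lemma exists_small_element_of_numberField (r : NonarchPlace F → ℝ) (hr : ∀ w, 0 < r w)
    (T₀ : Finset (NonarchPlace F)) (hT₀ : ∀ w ∉ T₀, r w = 1)
    (R : InfinitePlace F → ℝ) (hR : ∀ w, 0 < R w)
    (h : 1 < (∏ w, R w) * ∏ w ∈ T₀, r w) :
    ∃ n : ℕ, 0 < n ∧ ∃ x : F, x ≠ 0 ∧ (∀ w : NonarchPlace F, w.abv x ≤ r w ^ n) ∧
      ∀ w : InfinitePlace F, w x ^ w.mult ≤ R w ^ n := by
  classical
  obtain ⟨C, hC, hmink⟩ := exists_minkowski_constant F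
  have hint (w : NonarchPlace F) (a : ℤ) : w.abv (algebraMap ℤ F a) ≤ 1 :=
    intCast_mem (valuationRing w.abv w.nonarch) a
  have : Algebra.IsAlgebraic ℤ F :=
    ⟨fun x => (IsFractionRing.isAlgebraic_iff ℤ ℚ F).2 (Algebra.IsAlgebraic.isAlgebraic x)⟩
  obtain ⟨b, hb0, hb⟩ := NonarchPlace.exists_mul_abv_le_one T₀ (fun w _ => hint w) r hr
  have : NeZero b := ⟨hb0⟩
  have hcard : (Nat.card (ℤ ⧸ Ideal.span {b}) : ℝ) = |(b : ℝ)| := by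
    rw [Nat.card_congr (Int.quotientSpanEquivZMod b).toEquiv, Nat.card_zmod, Nat.cast_natAbs, Int.cast_abs]
  have hTf := NonarchPlace.finite_setOf_abv_lt_one (F := F) _ linearIndependent_int_le hb0
  let T := T₀ ∪ hTf.toFinset
  have hbF : algebraMap ℤ F b ≠ 0 := by simpa using hb0
  have hβ (w : NonarchPlace F) : 0 < w.abv (algebraMap ℤ F b) := w.abv.pos hbF
  have heasy := NonarchPlace.one_le_card_pow_mul_prod (F := F) _ linearIndependent_int_le hb0 T
    fun w _ => hint w
  rw [hcard] at heasy
  have hT1 (w : NonarchPlace F) (hw : w ∉ T) : r w = 1 ∧ w.abv (algebraMap ℤ F b) = 1 := by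
    simp only [T, Finset.mem_union, not_or, Set.Finite.mem_toFinset, Set.mem_ofPred_eq, not_and,
      not_lt] at hw
    exact ⟨hT₀ w hw.1, le_antisymm (hint w b) (hw.2 (hint w))⟩
  have hT : ∀ w ∈ T, r w * w.abv (algebraMap ℤ F b) ≤ 1 := by
    intro w _
    by_cases hw : w ∈ T₀
    · exact hb w hw
    · rw [hT₀ w hw, one_mul]; exact hint w b
  have hprod : ∏ w ∈ T₀, r w = ∏ w ∈ T, r w :=
    Finset.prod_subset Finset.subset_union_left fun w _ hw => hT₀ w hw
  rw [hprod] at h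
  set B := ∏ w ∈ T, w.abv (algebraMap ℤ F b)
  set R₀ := ∏ w ∈ T, r w
  set R₁ := ∏ w, R w
  let Q : ℝ := ∏ w ∈ T, (w.q : ℝ)
  have hQ : 0 < Q := Finset.prod_pos fun w _ => w.q_pos
  have hB : 0 < B := Finset.prod_pos fun w _ => hβ w
  have hR₀ : 0 < R₀ := Finset.prod_pos fun w _ => hr w
  -- Neither Q nor C depends on n. The maximum with 1 excludes n = 0.
  obtain ⟨n, hn⟩ := pow_unbounded_of_one_lt (max 1 (Q * C)) h
  have hn0 : 0 < n := by
    rcases Nat.eq_zero_or_pos n with rfl | hn0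
    · simp at hn
    · exact hn0
  choose k hk1 hk2 using fun w : NonarchPlace F =>
    w.exists_zpow_le_lt (pow_pos (mul_pos (hr w) (hβ w)) n)
  have hk0 : ∀ w ∈ T, 0 ≤ k w := by
    intro w hw
    have h1 := (hk1 w).trans (pow_le_one₀ (mul_pos (hr w) (hβ w)).le (hT w hw))
    rw [zpow_le_one_iff_right₀ w.one_lt_q] at h1
    lia
  have hO (w : NonarchPlace F) (x : 𝓞 F) : w.abv (x : F) ≤ 1 :=
    w.abv_le_one_of_isIntegral (hint w) x.2
  let H : AddSubgroup F := ⨅ w : T, w.1.ball (k w)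
  have hmemH {x : F} : x ∈ H ↔ ∀ w ∈ T, x ∈ w.ball (k w) := by
    simp [H, AddSubgroup.mem_iInf]
  -- These are the integers a with |a|_w ≤ (r(w)|b|_w)^n on T, after rounding the radii down to
  -- powers of q.
  let J : Ideal (𝓞 F) :=
    { H.comap (algebraMap (𝓞 F) F).toAddMonoidHom with
      smul_mem' := fun c x hx => by
        refine hmemH.2 fun w hw => ?_
        change w.abv ((algebraMap (𝓞 F) F) (c * x)) ≤ _
        rw [map_mul, map_mul]
        exact (mul_le_of_le_one_left (w.abv.nonneg _) (hO w c)).trans (hmemH.1 hx w hw) }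
  have hJ := NonarchPlace.relIndex_iInf_ball_le T (fun _ => 0) k hk0
    (algebraMap (𝓞 F) F).toAddMonoidHom.range (by
      rintro w _ _ ⟨x, rfl⟩
      exact w.mem_ball_zero.2 (hO w x))
  have hJn : Ideal.absNorm J = H.relIndex (algebraMap (𝓞 F) F).toAddMonoidHom.range := by
    rw [← AddSubgroup.index_comap]
    rfl
  rw [← hJn] at hJ
  have hJle : (Ideal.absNorm J : ℝ) ≤ Q / (R₀ * B) ^ n := by
    refine hJ.2.trans ?_
    have : Q / (R₀ * B) ^ n = ∏ w ∈ T, ((w.q : ℝ) / (r w * w.abv (algebraMap ℤ F b)) ^ n) := by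
      rw [Finset.prod_div_distrib, Finset.prod_pow, Finset.prod_mul_distrib]
    rw [this]
    refine Finset.prod_le_prod (fun w _ => (zpow_pos w.q_pos _).le) fun w _ => ?_
    rw [sub_zero]
    exact hk2 w
  have hJ0 : J ≠ ⊥ := by
    intro h0
    exact hJ.1 (by rw [h0, Ideal.absNorm_bot])
  have hroot (w : InfinitePlace F) : (R w ^ ((n : ℝ) / w.mult)) ^ w.mult = R w ^ n := by
    rw [← Real.rpow_mul_natCast (hR w).le, div_mul_cancel₀ _ (by simp [mult_ne_zero]),
      Real.rpow_natCast]
  have hbpos : 0 < |(b : ℝ)| := abs_pos.2 (by exact_mod_cast hb0)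
  -- The factor |b|^n anticipates the division by b^n. The exponent n / mult converts the normalized
  -- absolute value at w to the usual one.
  obtain ⟨a, haJ, ha0, ha⟩ := hmink J hJ0 (fun w => |(b : ℝ)| ^ n * R w ^ ((n : ℝ) / w.mult))
    (fun w => mul_pos (pow_pos hbpos n) (Real.rpow_pos_of_pos (hR w) _)) (by
    simp only [mul_pow, hroot]
    rw [Finset.prod_mul_distrib, Finset.prod_pow, Finset.prod_pow_eq_pow_sum, sum_mult_eq]
    calc (Ideal.absNorm J : ℝ) * C ≤ Q / (R₀ * B) ^ n * C := by gcongr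
      _ = Q * C / (R₀ * B) ^ n := by ring
      _ < _ := by
        rw [div_lt_iff₀ (by positivity)]
        calc Q * C < (R₁ * R₀) ^ n := (le_max_right _ _).trans_lt hn
          -- Clearing denominators costs nothing: the archimedean gain |b|^deg offsets the finite
          -- loss B, by the inequality form of the product formula.
          _ ≤ (R₁ * R₀) ^ n * (|(b : ℝ)| ^ (Module.finrank ℚ F) * B) ^ n :=
            le_mul_of_one_le_right (pow_nonneg (zero_le_one.trans h.le) _) (one_le_pow₀ heasy)
          _ = _ := by ring)
  have haF : (a : F) ≠ 0 := by simpa using ha0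
  refine ⟨n, hn0, (a : F) / (algebraMap ℤ F b) ^ n, div_ne_zero haF (pow_ne_zero n hbF), ?_, ?_⟩
  · intro w
    rw [map_div₀, map_pow, div_le_iff₀ (pow_pos (hβ w) n), ← mul_pow]
    by_cases hw : w ∈ T
    · exact (hmemH.1 haJ w hw).trans (hk1 w)
    · rw [(hT1 w hw).1, (hT1 w hw).2, mul_one, one_pow]
      exact hO w a
  · intro w
    have hwb : w (algebraMap ℤ F b) = |(b : ℝ)| := by
      rw [← w.norm_embedding_eq]
      simp
    rw [← hroot w]
    refine pow_le_pow_left₀ (apply_nonneg w _) ?_ _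
    rw [map_div₀, map_pow, hwb, div_le_iff₀' (pow_pos hbpos n)]
    exact (ha w).le

end NumberField

/-! ### Small elements of function fields by counting. -/

section FunctionField

open Polynomial

variable {p : ℕ} [Fact p.Prime] {F : Type} [Field F]

lemma card_quotient_span_singleton {b : (ZMod p)[X]} (hb : b ≠ 0) :
    Finite ((ZMod p)[X] ⧸ Ideal.span {b}) ∧
      Nat.card ((ZMod p)[X] ⧸ Ideal.span {b}) = p ^ b.natDegree := by
  have : Module.Finite (ZMod p) ((ZMod p)[X] ⧸ Ideal.span {b}) := by
    have : FiniteDimensional (ZMod p) (AdjoinRoot b) := (AdjoinRoot.powerBasis hb).finite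
    exact this
  refine ⟨Module.finite_of_finite (ZMod p), ?_⟩
  rw [Module.natCard_eq_pow_finrank (K := ZMod p), finrank_quotient_span_eq_natDegree, Nat.card_zmod]

section InverseVariable

variable (κ : ZMod p →+* F) {t : F}

/-- This exchanges t and 1/t, so that places over ∞ can be treated as places at which a polynomial
ring is integral. -/
lemma eval₂_inv_mul_pow (ht : t ≠ 0) (N : ℕ) {f : (ZMod p)[X]} (hf : f.natDegree ≤ N) :
    eval₂ κ t⁻¹ (reflect N f) * t ^ N = eval₂ κ t f := by
  let := invertibleOfNonzero ht
  rw [← invOf_eq_inv]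
  exact eval₂_reflect_mul_pow κ t N f hf

lemma abv_zmod_le_one (w : NonarchPlace F) (c : ZMod p) : w.abv (κ c) ≤ 1 := by
  have : κ c = (c.val : F) := by
    conv_lhs => rw [← ZMod.natCast_zmod_val c]
    rw [map_natCast]
  rw [this]
  exact natCast_mem (valuationRing w.abv w.nonarch) c.val

lemma abv_zmod_eq_one (w : NonarchPlace F) {c : ZMod p} (hc : c ≠ 0) : w.abv (κ c) = 1 := by
  refine le_antisymm (abv_zmod_le_one κ w c) ?_
  have h : w.abv (κ c) * w.abv (κ c⁻¹) = 1 := by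
    rw [← map_mul, ← map_mul, mul_inv_cancel₀ hc, map_one, map_one]
  rw [← h]
  exact mul_le_of_le_one_right (w.abv.nonneg _) (abv_zmod_le_one κ w _)

lemma abv_eval₂_le_one (w : NonarchPlace F) {x : F} (hx : w.abv x ≤ 1) (f : (ZMod p)[X]) :
    w.abv (eval₂ κ x f) ≤ 1 := by
  let := κ.toAlgebra
  exact w.abv_aeval_le_one (abv_zmod_le_one κ w) hx f

lemma abv_inv_le_one {w : NonarchPlace F} (ht : 1 < w.abv t) : w.abv t⁻¹ < 1 := by
  rw [map_inv₀]; exact inv_lt_one_of_one_lt₀ ht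

lemma abv_eval₂_le_pow {w : NonarchPlace F} (ht : 1 < w.abv t) (N : ℕ) {f : (ZMod p)[X]}
    (hf : f.natDegree ≤ N) : w.abv (eval₂ κ t f) ≤ w.abv t ^ N := by
  have ht0 : t ≠ 0 := by rintro rfl; rw [map_zero] at ht; linarith
  rw [← eval₂_inv_mul_pow κ ht0 N hf, map_mul, map_pow]
  exact mul_le_of_le_one_left (pow_nonneg (w.abv.nonneg _) _)
    (abv_eval₂_le_one κ w (abv_inv_le_one ht).le _)

/-- At a place with |t| > 1 the leading term dominates: after division by t^deg, the leading
coefficient has absolute value 1 and the remaining terms are multiples of 1/t. -/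
lemma pow_le_abv_eval₂ {w : NonarchPlace F} (ht : 1 < w.abv t) {f : (ZMod p)[X]}
    (hf : f ≠ 0) : w.abv t ^ f.natDegree ≤ w.abv (eval₂ κ t f) := by
  have ht0 : t ≠ 0 := by rintro rfl; rw [map_zero] at ht; linarith
  rw [← eval₂_inv_mul_pow κ ht0 _ le_rfl, map_mul, map_pow]
  refine le_mul_of_one_le_left (pow_nonneg (w.abv.nonneg _) _) ?_
  change 1 ≤ w.abv (eval₂ κ t⁻¹ f.reverse)
  have h2 := congrArg (eval₂ κ t⁻¹) (divX_mul_X_add f.reverse)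
  rw [eval₂_add, eval₂_mul, eval₂_X, eval₂_C, coeff_zero_reverse] at h2
  have h3 : κ f.leadingCoeff = eval₂ κ t⁻¹ f.reverse + -(eval₂ κ t⁻¹ f.reverse.divX * t⁻¹) := by
    linear_combination h2
  have h4 := w.nonarch (eval₂ κ t⁻¹ f.reverse) (-(eval₂ κ t⁻¹ f.reverse.divX * t⁻¹))
  rw [← h3, abv_zmod_eq_one κ w (leadingCoeff_ne_zero.2 hf), map_neg_eq_map, map_mul] at h4
  have h5 := (mul_le_of_le_one_left (w.abv.nonneg t⁻¹)
    (abv_eval₂_le_one κ w (abv_inv_le_one ht).le f.reverse.divX)).trans_lt (abv_inv_le_one ht)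
  rcases le_max_iff.1 h4 with h | h
  · exact h
  · exact absurd h5 (not_lt.2 h)

/-- The places over `∞`: they are finite in number, and the product of the absolute values of
`t` at these places is at most `p ^ N`. -/
lemma infinite_places_bound (ht : Function.Injective (eval₂RingHom κ t)) (N : ℕ)
    (hN : ∀ (m : ℕ) (s : Fin m → F),
      (∀ g : Fin m → (ZMod p)[X], ∑ i, eval₂ κ t (g i) * s i = 0 → ∀ i, g i = 0) → m ≤ N) :
    {w : NonarchPlace F | 1 < w.abv t}.Finite ∧ ∀ T : Finset (NonarchPlace F),
      (∀ w ∈ T, 1 < w.abv t) → ∏ w ∈ T, w.abv t ≤ (p : ℝ) ^ N := by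
  have ht0 : t ≠ 0 := by
    rintro rfl
    exact X_ne_zero (ht (by simp) : (X : (ZMod p)[X]) = 0)
  have hrefl (n : ℕ) {f : (ZMod p)[X]} (hf : f.natDegree ≤ n) :
      eval₂ κ t (reflect n f) = eval₂ κ t⁻¹ f * t ^ n := by
    have h := eval₂_inv_mul_pow κ ht0 n (f := reflect n f)
      ((natDegree_reflect_le).trans (max_le le_rfl hf))
    rw [reflect_reflect] at h
    exact h.symm
  -- Over 𝔽_p[1/t], the places with |t| > 1 are places of integrality dividing the variable. The
  -- earlier bounds then apply with b = X, whose residue ring has p elements.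
  let φ : (ZMod p)[X] →+* F := eval₂RingHom κ t⁻¹
  let := φ.toAlgebra
  have hφ : algebraMap (ZMod p)[X] F = φ := rfl
  have : FaithfulSMul (ZMod p)[X] F := by
    rw [faithfulSMul_iff_algebraMap_injective, hφ, injective_iff_map_eq_zero]
    intro f hf
    have h1 := hrefl f.natDegree (le_refl f.natDegree)
    rw [show eval₂ κ t⁻¹ f = 0 from hf, zero_mul] at h1
    have h2 : reflect f.natDegree f = 0 := ht (by rw [map_zero]; exact h1)
    exact reflect_eq_zero_iff.1 h2
  have hN' : ∀ (m : ℕ) (s : Fin m → F), LinearIndependent (ZMod p)[X] s → m ≤ N := by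
    intro m s hs
    refine hN m s fun g hg => ?_
    -- Reflecting all coefficients in the same degree n turns a relation over 𝔽_p[t] into one over
    -- 𝔽_p[1/t].
    let n := Finset.univ.sup fun i => (g i).natDegree
    have hn (i) : (g i).natDegree ≤ n :=
      Finset.le_sup (f := fun i => (g i).natDegree) (Finset.mem_univ i)
    have h1 := Fintype.linearIndependent_iff.1 hs (fun i => reflect n (g i)) (by
      have h2 : (∑ i, reflect n (g i) • s i) * t ^ n = 0 := by
        rw [Finset.sum_mul, ← hg]
        refine Finset.sum_congr rfl fun i _ => ?_
        rw [← eval₂_inv_mul_pow κ ht0 n (hn i), Algebra.smul_def, hφ]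
        change eval₂ κ t⁻¹ _ * _ * _ = _
        ring
      exact (mul_eq_zero.1 h2).resolve_right (pow_ne_zero _ ht0))
    exact fun i => reflect_eq_zero_iff.1 (h1 i)
  obtain ⟨hfin, hcard⟩ := card_quotient_span_singleton (p := p) X_ne_zero
  have hX : algebraMap (ZMod p)[X] F X = t⁻¹ := by rw [hφ]; simp [φ]
  have hle (w : NonarchPlace F) (hw : 1 < w.abv t) (a : (ZMod p)[X]) :
      w.abv (algebraMap (ZMod p)[X] F a) ≤ 1 :=
    abv_eval₂_le_one κ w (abv_inv_le_one hw).le a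
  constructor
  · refine (NonarchPlace.finite_setOf_abv_lt_one N hN' (X_ne_zero (R := ZMod p))).subset fun w hw => ?_
    exact ⟨hle w hw, by rw [hX]; exact abv_inv_le_one hw⟩
  · intro T hT
    have h := NonarchPlace.one_le_card_pow_mul_prod N hN' (X_ne_zero (R := ZMod p)) T
      fun w hw => hle w (hT w hw)
    rw [hX, hcard, natDegree_X, pow_one] at h
    simp only [map_inv₀] at h
    rwa [Finset.prod_inv_distrib, ← div_eq_mul_inv, one_le_div] at h
    exact Finset.prod_pos fun w hw => one_pos.trans (hT w hw)

end InverseVariable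

/-- The pigeonhole principle replaces Minkowski's theorem. Combinations of an integral basis with
polynomial coefficients of degree at most m form a finite group of order p^(N(m+1)). The subgroup
satisfying the local conditions has smaller index than this order, so it is nonzero. As for number
fields, x = a / b^n. -/
lemma exists_small_element_of_functionField (p : ℕ) [Fact p.Prime] {F : Type} [Field F]
    [Algebra (ZMod p)[X] F] [Algebra (RatFunc (ZMod p)) F]
    [IsScalarTower (ZMod p)[X] (RatFunc (ZMod p)) F] [FiniteDimensional (RatFunc (ZMod p)) F]
    (r : NonarchPlace F → ℝ) (hr : ∀ w, 0 < r w)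
    (T₀ : Finset (NonarchPlace F)) (hT₀ : ∀ w ∉ T₀, r w = 1) (h : 1 < ∏ w ∈ T₀, r w) :
    ∃ n : ℕ, 0 < n ∧ ∃ x : F, x ≠ 0 ∧ ∀ w : NonarchPlace F, w.abv x ≤ r w ^ n := by
  classical
  let K := RatFunc (ZMod p)
  let N := Module.finrank K F
  have hinj : Function.Injective (algebraMap (ZMod p)[X] F) := by
    rw [IsScalarTower.algebraMap_eq (ZMod p)[X] K F]
    exact (algebraMap K F).injective.comp (IsFractionRing.injective (ZMod p)[X] K)
  have : FaithfulSMul (ZMod p)[X] F := (faithfulSMul_iff_algebraMap_injective _ _).2 hinj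
  have : Algebra.IsAlgebraic (ZMod p)[X] F :=
    ⟨fun x => (IsFractionRing.isAlgebraic_iff (ZMod p)[X] K F).2 (Algebra.IsAlgebraic.isAlgebraic x)⟩
  have hN : ∀ (m : ℕ) (s : Fin m → F), LinearIndependent (ZMod p)[X] s → m ≤ N := by
    intro m s hs
    have := ((LinearIndependent.iff_fractionRing (ZMod p)[X] K).1 hs).fintype_card_le_finrank
    simpa using this
  let κ : ZMod p →+* F := (algebraMap (ZMod p)[X] F).comp C
  let t : F := algebraMap (ZMod p)[X] F X
  have heval (f : (ZMod p)[X]) : eval₂ κ t f = algebraMap (ZMod p)[X] F f := by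
    have : eval₂RingHom κ t = algebraMap (ZMod p)[X] F := by
      ext <;> simp [κ, t]
    exact congrArg (fun g : (ZMod p)[X] →+* F => g f) this
  obtain ⟨hTif, hTi⟩ := infinite_places_bound κ (t := t) (by
      rw [show eval₂RingHom κ t = algebraMap (ZMod p)[X] F from RingHom.ext heval]
      exact hinj) N (by
      intro m s hs
      refine hN m s (Fintype.linearIndependent_iff.2 fun g hg => hs g ?_)
      simpa only [heval, Algebra.smul_def] using hg)
  let Ti := hTif.toFinset
  have hmemTi (w : NonarchPlace F) : w ∈ Ti ↔ 1 < w.abv t := by simp [Ti]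
  have hint (w : NonarchPlace F) (hw : w ∉ Ti) (a : (ZMod p)[X]) :
      w.abv (algebraMap (ZMod p)[X] F a) ≤ 1 := by
    rw [← heval]
    exact abv_eval₂_le_one κ w (by rwa [hmemTi, not_lt] at hw) a
  -- Polynomials in t are not integral at the places over ∞, so b clears the radii only at the other
  -- places.
  obtain ⟨b, hb0, hb⟩ := NonarchPlace.exists_mul_abv_le_one (A := (ZMod p)[X]) (T₀ \ Ti)
    (fun w hw => hint w (Finset.mem_sdiff.1 hw).2) r hr
  obtain ⟨hfin, hcard⟩ := card_quotient_span_singleton hb0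
  have hTff := NonarchPlace.finite_setOf_abv_lt_one (F := F) N hN hb0
  let Tf := (T₀ ∪ hTff.toFinset) \ Ti
  have hdisj : Disjoint Tf Ti := Finset.sdiff_disjoint
  let T := Tf ∪ Ti
  have hbF : algebraMap (ZMod p)[X] F b ≠ 0 := by
    rwa [Ne, FaithfulSMul.algebraMap_eq_zero_iff]
  have hβ (w : NonarchPlace F) : 0 < w.abv (algebraMap (ZMod p)[X] F b) := w.abv.pos hbF
  have heasy := NonarchPlace.one_le_card_pow_mul_prod (F := F) N hN hb0 Tf
    fun w hw => hint w (Finset.mem_sdiff.1 hw).2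
  rw [hcard] at heasy
  have hT1 (w : NonarchPlace F) (hw : w ∉ T) :
      r w = 1 ∧ w.abv (algebraMap (ZMod p)[X] F b) = 1 ∧ w ∉ Ti := by
    have h1 : w ∉ Ti := fun h => hw (Finset.mem_union_right _ h)
    have h2 : w ∉ T₀ ∪ hTff.toFinset := fun h =>
      hw (Finset.mem_union_left _ (Finset.mem_sdiff.2 ⟨h, h1⟩))
    simp only [Finset.mem_union, not_or, Set.Finite.mem_toFinset, Set.mem_ofPred_eq, not_and,
      not_lt] at h2
    exact ⟨hT₀ w h2.1, le_antisymm (hint w h1 b) (h2.2 (hint w h1)), h1⟩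
  have hTf : ∀ w ∈ Tf, r w * w.abv (algebraMap (ZMod p)[X] F b) ≤ 1 := by
    intro w hw'
    have hwi := (Finset.mem_sdiff.1 hw').2
    by_cases hw : w ∈ T₀
    · exact hb w (Finset.mem_sdiff.2 ⟨hw, hwi⟩)
    · rw [hT₀ w hw, one_mul]; exact hint w hwi b
  have hprod : ∏ w ∈ T₀, r w = ∏ w ∈ T, r w := by
    refine Finset.prod_subset (fun w hw => ?_) fun w _ hw => hT₀ w hw
    by_cases hwi : w ∈ Ti
    · exact Finset.mem_union_right _ hwi
    · exact Finset.mem_union_left _ (Finset.mem_sdiff.2 ⟨Finset.mem_union_left _ hw, hwi⟩)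
  rw [hprod] at h
  let D := b.natDegree
  -- At the places over ∞ the lower bound |t|^D replaces |b|; its product over these places is τ^D,
  -- which can be compared with the power of τ in the pole bound.
  let σ : NonarchPlace F → ℝ := fun w =>
    if w ∈ Ti then w.abv t ^ D else w.abv (algebraMap (ZMod p)[X] F b)
  have hσ (w) : 0 < σ w := by
    by_cases hw : w ∈ Ti
    · simp only [σ, if_pos hw]
      exact pow_pos (one_pos.trans ((hmemTi w).1 hw)) _
    · simp only [σ, if_neg hw]
      exact hβ w
  have hσle (w) : σ w ≤ w.abv (algebraMap (ZMod p)[X] F b) := by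
    by_cases hw : w ∈ Ti
    · simp only [σ, if_pos hw]
      rw [← heval]
      exact pow_le_abv_eval₂ κ ((hmemTi w).1 hw) hb0
    · simp only [σ, if_neg hw]; exact le_rfl
  set B := ∏ w ∈ Tf, w.abv (algebraMap (ZMod p)[X] F b)
  set R := ∏ w ∈ T, r w
  let τ : ℝ := ∏ w ∈ Ti, w.abv t
  have hτ : τ ≤ (p : ℝ) ^ N := hTi Ti fun w hw => (hmemTi w).1 hw
  have hσprod : ∏ w ∈ T, σ w = B * τ ^ D := by
    rw [Finset.prod_union hdisj, ← Finset.prod_pow]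
    congr 1
    · exact Finset.prod_congr rfl fun w hw => if_neg (Finset.mem_sdiff.1 hw).2
    · exact Finset.prod_congr rfl fun w hw => if_pos hw
  obtain ⟨s, bs, hbs⟩ := FiniteDimensional.exists_is_basis_integral (ZMod p)[X] K F
  -- Basis elements are integral away from ∞; at the places over ∞, q^(-c) bounds their poles.
  have hc (w : NonarchPlace F) : ∃ c : ℤ, ∀ i : s, w.abv (bs i) ≤ (w.q : ℝ) ^ (-c) := by
    obtain ⟨m, hm⟩ := pow_unbounded_of_one_lt (∑ i : s, w.abv (bs i)) w.one_lt_q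
    refine ⟨-m, fun i => ?_⟩
    rw [neg_neg, zpow_natCast]
    exact (Finset.single_le_sum (f := fun i : s => w.abv (bs i))
      (fun i _ => w.abv.nonneg _) (Finset.mem_univ i)).trans hm.le
  choose c hc using hc
  choose e he using fun w : NonarchPlace F => w.exists_abv_eq_zpow (x := t) (by
    rw [Ne, FaithfulSMul.algebraMap_eq_zero_iff]; exact X_ne_zero)
  let Q : ℝ := ∏ w ∈ T, (w.q : ℝ)
  let Cc : ℝ := ∏ w ∈ Ti, (w.q : ℝ) ^ (-c w)
  have hQ : 0 < Q := Finset.prod_pos fun w _ => w.q_pos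
  have hCc : 0 < Cc := Finset.prod_pos fun w _ => zpow_pos w.q_pos _
  have hB : 0 < B := Finset.prod_pos fun w _ => hβ w
  have hR : 0 < R := Finset.prod_pos fun w _ => hr w
  have hτ0 : 0 < τ := Finset.prod_pos fun w hw => one_pos.trans ((hmemTi w).1 hw)
  obtain ⟨n, hn⟩ := pow_unbounded_of_one_lt (max 1 (Q * Cc)) h
  have hn0 : 0 < n := by
    rcases Nat.eq_zero_or_pos n with rfl | hn0
    · simp at hn
    · exact hn0
  choose k hk1 hk2 using fun w : NonarchPlace F =>
    w.exists_zpow_le_lt (pow_pos (mul_pos (hr w) (hσ w)) n)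
  -- The first term ensures m ≥ nD for the comparison of powers of τ. The sum makes the ambient ball
  -- contain the target ball at each place over ∞, where the exponent `e w` of t is at most -1.
  let m : ℕ := n * D + ∑ w ∈ Ti, (c w - k w).toNat
  have hm : n * D ≤ m := Nat.le_add_right _ _
  let l : NonarchPlace F → ℤ := fun w => if w ∈ Ti then c w + e w * m else 0
  have hlTi {w : NonarchPlace F} (hw : w ∈ Ti) :
      (w.q : ℝ) ^ (-l w) = (w.q : ℝ) ^ (-c w) * w.abv t ^ m := by
    simp only [l, if_pos hw]
    rw [neg_add, zpow_add₀ w.q_ne_zero, he, ← zpow_natCast, ← zpow_mul, neg_mul]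
  have hl : ∀ w ∈ T, l w ≤ k w := by
    intro w hw
    by_cases hwi : w ∈ Ti
    · simp only [l, if_pos hwi]
      have h1 := (hmemTi w).1 hwi
      rw [he, one_lt_zpow_iff_right₀ w.one_lt_q] at h1
      have h2 : (c w - k w).toNat ≤ m := (Finset.single_le_sum
        (f := fun w => (c w - k w).toNat) (fun _ _ => Nat.zero_le _) hwi).trans
          (Nat.le_add_left _ _)
      have h3 : c w - k w ≤ m := by lia
      nlinarith
    · simp only [l, if_neg hwi]
      have hwf := (Finset.mem_union.1 hw).resolve_right hwi
      have h1 := (hk1 w).trans (pow_le_one₀ (mul_pos (hr w) (hσ w)).le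
        ((mul_le_mul_of_nonneg_left (hσle w) (hr w).le).trans (hTf w hwf)))
      rw [zpow_le_one_iff_right₀ w.one_lt_q] at h1
      lia
  let Ψ : (s → degreeLT (ZMod p) (m + 1)) →+ F :=
    { toFun := fun g => ∑ i, algebraMap (ZMod p)[X] F (g i) * bs i
      map_zero' := by simp
      map_add' := fun g g' => by simp [add_mul, Finset.sum_add_distrib] }
  have hΨ : Function.Injective Ψ := by
    rw [injective_iff_map_eq_zero]
    intro g hg
    have h1 := (LinearIndependent.iff_fractionRing (ZMod p)[X] K).2 bs.linearIndependent
    have h2 := Fintype.linearIndependent_iff.1 h1 (fun i => (g i : (ZMod p)[X])) (by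
      simp only [Algebra.smul_def]
      exact hg)
    exact funext fun i => Subtype.ext (h2 i)
  have hcardL : Nat.card Ψ.range = p ^ (N * (m + 1)) := by
    rw [Nat.card_congr (Ψ.ofInjective hΨ).symm.toEquiv, Nat.card_fun,
      Nat.card_congr (degreeLTEquiv (ZMod p) (m + 1)).toEquiv, Nat.card_fun, Nat.card_fin,
      Nat.card_zmod, ← pow_mul, mul_comm, ← Module.finrank_eq_nat_card_basis bs]
  have hL : ∀ w : NonarchPlace F, Ψ.range ≤ w.ball (l w) := by
    rintro w _ ⟨g, rfl⟩
    refine sum_mem fun i _ => ?_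
    rw [NonarchPlace.mem_ball, map_mul]
    by_cases hw : w ∈ Ti
    · rw [hlTi hw, mul_comm]
      refine mul_le_mul (hc w i) ?_ (w.abv.nonneg _) (zpow_pos w.q_pos _).le
      rw [← heval]
      refine abv_eval₂_le_pow κ ((hmemTi w).1 hw) m ?_
      have h1 := mem_degreeLT.1 (g i).2
      rcases eq_or_ne (g i : (ZMod p)[X]) 0 with h0 | h0
      · rw [h0, natDegree_zero]; exact Nat.zero_le _
      · exact Nat.lt_succ_iff.1 ((natDegree_lt_iff_degree_lt h0).2 h1)
    · simp only [l, if_neg hw, neg_zero, zpow_zero]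
      exact mul_le_one₀ (hint w hw _) (w.abv.nonneg _)
        (w.abv_le_one_of_isIntegral (hint w hw) (hbs i))
  let H : AddSubgroup F := ⨅ w : T, w.1.ball (k w)
  have hmemH {x : F} : x ∈ H ↔ ∀ w ∈ T, x ∈ w.ball (k w) := by
    simp [H, AddSubgroup.mem_iInf]
  have hidx := (NonarchPlace.relIndex_iInf_ball_le T l k hl Ψ.range fun w _ => hL w).2
  have hlt : H.relIndex Ψ.range < Nat.card Ψ.range := by
    have h1 : ∏ w ∈ T, (w.q : ℝ) ^ (k w - l w) ≤
        Q / (R * (B * τ ^ D)) ^ n * (Cc * τ ^ m) := by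
      have h2 : Q / (R * (B * τ ^ D)) ^ n = ∏ w ∈ T, ((w.q : ℝ) / (r w * σ w) ^ n) := by
        rw [Finset.prod_div_distrib, Finset.prod_pow, Finset.prod_mul_distrib, hσprod]
      have h3 : Cc * τ ^ m = ∏ w ∈ T, (w.q : ℝ) ^ (-l w) := by
        rw [Finset.prod_union hdisj, Finset.prod_congr rfl fun w hw => hlTi hw,
          Finset.prod_mul_distrib, Finset.prod_pow, Finset.prod_eq_one, one_mul]
        intro w hw
        simp only [l, if_neg (Finset.mem_sdiff.1 hw).2, neg_zero, zpow_zero]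
      rw [h2, h3, ← Finset.prod_mul_distrib]
      refine Finset.prod_le_prod (fun w _ => (zpow_pos w.q_pos _).le) fun w _ => ?_
      rw [sub_eq_add_neg, zpow_add₀ w.q_ne_zero]
      exact mul_le_mul_of_nonneg_right (hk2 w) (zpow_pos w.q_pos _).le
    have hp : (0 : ℝ) < p := by exact_mod_cast (Fact.out : p.Prime).pos
    have hp1 : (1 : ℝ) ≤ p := by exact_mod_cast (Fact.out : p.Prime).one_lt.le
    -- Split off τ^(nD) to cancel the contribution of σ. The rest is bounded by τ ≤ p^N, and the
    -- factor B^n is inserted using the lower bound for B.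
    have h2 : τ ^ m ≤ τ ^ (D * n) * (B ^ n * (p : ℝ) ^ (N * m)) := by
      obtain ⟨j, hj⟩ := Nat.exists_eq_add_of_le hm
      have h3 : 1 ≤ (((p ^ D : ℕ) : ℝ) ^ N * B) ^ n := one_le_pow₀ heasy
      calc τ ^ m = τ ^ (D * n) * τ ^ j := by rw [hj, pow_add, mul_comm n D]
        _ ≤ τ ^ (D * n) * ((p : ℝ) ^ N) ^ j := by gcongr
        _ ≤ τ ^ (D * n) * (((p : ℝ) ^ N) ^ j * (((p ^ D : ℕ) : ℝ) ^ N * B) ^ n) := by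
          gcongr
          exact le_mul_of_one_le_right (by positivity) h3
        _ = _ := by
          rw [hj]
          push_cast
          ring
    have h4 : (H.relIndex Ψ.range : ℝ) < (p : ℝ) ^ (N * (m + 1)) := by
      calc (H.relIndex Ψ.range : ℝ) ≤ Q / (R * (B * τ ^ D)) ^ n * (Cc * τ ^ m) := hidx.trans h1
        _ ≤ Q / (R * (B * τ ^ D)) ^ n * (Cc * (τ ^ (D * n) * (B ^ n * (p : ℝ) ^ (N * m)))) := by
          gcongr
        _ = Q * Cc / R ^ n * (p : ℝ) ^ (N * m) := by
          rw [mul_pow, mul_pow, ← pow_mul]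
          field_simp
        _ < 1 * (p : ℝ) ^ (N * m) := by
          refine mul_lt_mul_of_pos_right ?_ (by positivity)
          rw [div_lt_one (by positivity)]
          exact (le_max_right _ _).trans_lt hn
        _ ≤ _ := by
          rw [one_mul]
          exact pow_le_pow_right₀ hp1 (Nat.mul_le_mul_left _ (Nat.le_succ m))
    rw [hcardL]
    exact_mod_cast h4
  -- The trivial subgroup would have index equal to the order of the whole group.
  have hne : H.addSubgroupOf Ψ.range ≠ ⊥ := by
    intro hbot
    rw [AddSubgroup.relIndex, hbot, AddSubgroup.index_bot] at hlt
    exact lt_irrefl _ hlt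
  obtain ⟨⟨⟨a, haL⟩, haH⟩, ha0⟩ := AddSubgroup.ne_bot_iff_exists_ne_zero.1 hne
  rw [AddSubgroup.mem_addSubgroupOf] at haH
  have ha0' : a ≠ 0 := fun h => ha0 (by ext; exact h)
  refine ⟨n, hn0, a / (algebraMap (ZMod p)[X] F b) ^ n, div_ne_zero ha0' (pow_ne_zero n hbF), ?_⟩
  intro w
  rw [map_div₀, map_pow, div_le_iff₀ (pow_pos (hβ w) n), ← mul_pow]
  by_cases hw : w ∈ T
  · refine ((hmemH.1 haH w hw).trans (hk1 w)).trans ?_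
    exact pow_le_pow_left₀ (mul_pos (hr w) (hσ w)).le
      (mul_le_mul_of_nonneg_left (hσle w) (hr w).le) _
  · obtain ⟨h1, h2, h3⟩ := hT1 w hw
    rw [h1, h2, mul_one, one_pow]
    have := hL w haL
    simpa only [l, if_neg h3, NonarchPlace.mem_ball_zero] using this

end FunctionField

/-! ### Global fields: small elements and infinitely many algebraic numbers in the disks. -/

section GlobalField

variable {F : Type} [Field F]

lemma NonarchPlace.norm_embedding (w : NonarchPlace F) (a : F) : ‖w.embedding a‖ = w.abv a := by
  change ‖((algebraMap w.Completion w.AlgCl ((WithAbs.toAbs w.abv a : WithAbs w.abv) :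
    w.Completion) : w.AlgCl) : w.Cw)‖ = _
  rw [UniformSpace.Completion.norm_coe]
  refine (spectralNorm_extends (K := w.Completion) (L := w.AlgCl) _).trans ?_
  exact UniformSpace.Completion.norm_coe _

lemma Place.nabs_mul (v : Place F) (x y : v.Cv) : v.nabs (x * y) = v.nabs x * v.nabs y := by
  rw [Place.nabs, norm_mul, mul_pow]
  rfl

lemma Place.nabs_pow (v : Place F) (x : v.Cv) (n : ℕ) : v.nabs (x ^ n) = v.nabs x ^ n := by
  rw [Place.nabs, norm_pow, ← pow_mul, mul_comm, pow_mul]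
  rfl

lemma Place.nabs_nonneg (v : Place F) (x : v.Cv) : 0 ≤ v.nabs x := pow_nonneg (norm_nonneg _) _

lemma Place.nabs_one (v : Place F) : v.nabs 1 = 1 := by
  rw [Place.nabs, norm_one, one_pow]

lemma finprod_place [Fintype (NumberField.InfinitePlace F)] (r : Place F → ℝ)
    (T : Finset (NonarchPlace F)) (hT : ∀ w ∉ T, r (.nonarch w) = 1) :
    ∏ᶠ v, r v = (∏ w, r (.arch w)) * ∏ w ∈ T, r (.nonarch w) := by
  classical
  let S : Finset (Place F) := Finset.univ.image Place.arch ∪ T.image Place.nonarch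
  have hS : Function.mulSupport r ⊆ S := by
    rintro (w | w) hv
    · simp [S]
    · have : w ∈ T := by
        by_contra h
        exact hv (hT w h)
      simp [S, this]
  have hdisj : Disjoint (Finset.univ.image (Place.arch (F := F))) (T.image Place.nonarch) := by
    rw [Finset.disjoint_left]
    simp
  rw [finprod_eq_prod_of_mulSupport_subset r hS, Finset.prod_union hdisj,
    Finset.prod_image (fun _ _ _ _ h => Place.arch.inj h),
    Finset.prod_image (fun _ _ _ _ h => Place.nonarch.inj h)]

/-- This unites the two kinds of global field. In characteristic p there is no embedding in ℂ, so
the archimedean factor of the product is empty. -/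
theorem exists_small_element (hF : IsGlobalField F) (r : Place F → ℝ) (hr : ∀ v, 0 < r v)
    (hfin : {v | r v ≠ 1}.Finite) (h : 1 < ∏ᶠ v, r v) :
    ∃ n : ℕ, 0 < n ∧ ∃ x : F, x ≠ 0 ∧ ∀ v : Place F, v.nabs (v.embedding x) ≤ r v ^ n := by
  have hfin' : {w : NonarchPlace F | r (.nonarch w) ≠ 1}.Finite :=
    hfin.preimage (f := Place.nonarch) (fun _ _ _ _ h => Place.nonarch.inj h)
  have hT : ∀ w ∉ hfin'.toFinset, r (.nonarch w) = 1 := by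
    intro w hw
    simpa using hw
  suffices ∃ n : ℕ, 0 < n ∧ ∃ x : F, x ≠ 0 ∧
      (∀ w : NonarchPlace F, w.abv x ≤ r (.nonarch w) ^ n) ∧
      ∀ w : NumberField.InfinitePlace F, w x ^ w.mult ≤ r (.arch w) ^ n by
    obtain ⟨n, hn, x, hx, h1, h2⟩ := this
    refine ⟨n, hn, x, hx, ?_⟩
    rintro (w | w)
    · change ‖w.embedding x‖ ^ w.mult ≤ _
      rw [w.norm_embedding_eq]
      exact h2 w
    · change ‖w.embedding x‖ ^ 1 ≤ _
      rw [w.norm_embedding, pow_one]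
      exact h1 w
  obtain hNF | ⟨p, hp, hA, hFF⟩ := hF
  · rw [finprod_place r _ hT] at h
    exact exists_small_element_of_numberField (fun w => r (.nonarch w)) (fun _ => hr _) _ hT
      (fun w => r (.arch w)) (fun _ => hr _) h
  · have hchar : CharP F p := by
      have : CharP (RatFunc (ZMod p)) p := inferInstance
      exact charP_of_injective_algebraMap (algebraMap (RatFunc (ZMod p)) F).injective p
    have hempty : IsEmpty (NumberField.InfinitePlace F) := by
      refine ⟨fun w => ?_⟩
      have := charP_of_injective_ringHom w.embedding.injective p
      exact hp.out.ne_zero (CharP.eq ℂ this (CharP.ofCharZero ℂ))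
    have : Fintype (NumberField.InfinitePlace F) := Fintype.ofIsEmpty
    rw [finprod_place r _ hT, Finset.prod_of_isEmpty, one_mul] at h
    let : Algebra (Polynomial (ZMod p)) F :=
      ((algebraMap (RatFunc (ZMod p)) F).comp (algebraMap (Polynomial (ZMod p)) _)).toAlgebra
    have : IsScalarTower (Polynomial (ZMod p)) (RatFunc (ZMod p)) F :=
      IsScalarTower.of_algebraMap_eq fun _ => rfl
    have : FiniteDimensional (RatFunc (ZMod p)) F := hFF
    obtain ⟨n, hn, x, hx, h1⟩ := exists_small_element_of_functionField p (fun w => r (.nonarch w))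
      (fun _ => hr _) _ hT h
    exact ⟨n, hn, x, hx, h1, fun w => (hempty.false w).elim⟩

/-- For n nonzero in K there are n distinct n-th roots of unity, and such n can be taken arbitrarily
large. -/
lemma infinite_setOf_pow_eq_one (K : Type) [Field K] [IsAlgClosed K] :
    {z : K | ∃ k : ℕ, 0 < k ∧ z ^ k = 1}.Infinite := by
  classical
  intro hfin
  obtain ⟨n, hn, hn0⟩ : ∃ n : ℕ, hfin.toFinset.card < n ∧ (n : K) ≠ 0 := by
    -- Two consecutive integers cannot both vanish in K.
    by_cases h : ((hfin.toFinset.card + 1 : ℕ) : K) = 0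
    · refine ⟨hfin.toFinset.card + 2, by lia, fun h' => ?_⟩
      have : (1 : K) = ((hfin.toFinset.card + 2 : ℕ) : K) - ((hfin.toFinset.card + 1 : ℕ) : K) := by
        push_cast; ring
      rw [h, h', sub_zero] at this
      exact one_ne_zero this
    · exact ⟨_, Nat.lt_succ_self _, h⟩
  have : NeZero (n : K) := ⟨hn0⟩
  obtain ⟨ζ, hζ⟩ := HasEnoughRootsOfUnity.exists_primitiveRoot K n
  have hsub : Polynomial.nthRootsFinset n (1 : K) ⊆ hfin.toFinset := by
    intro z hz
    rw [Polynomial.mem_nthRootsFinset (by lia)] at hz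
    rw [Set.Finite.mem_toFinset]
    exact ⟨n, by lia, hz⟩
  have := Finset.card_le_card hsub
  rw [hζ.card_nthRootsFinset] at this
  lia

/-- If `∏_v r(v) > 1`, then infinitely many algebraic numbers lie with all their conjugates in the
disks of radius `r(v)`. -/
theorem infinite_conjugates_in_disks (hF : IsGlobalField F) (r : Place F → ℝ) (hr : ∀ v, 0 < r v)
    (hfin : {v | r v ≠ 1}.Finite) (h : 1 < ∏ᶠ v, r v) :
    {z : AlgebraicClosure F | ∀ (v : Place F) (τ : AlgebraicClosure F →ₐ[F] v.Cv),
      v.nabs (τ z) ≤ r v}.Infinite := by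
  obtain ⟨n, hn, x, hx, hle⟩ := exists_small_element hF r hr hfin h
  obtain ⟨y, hy⟩ := IsAlgClosed.exists_pow_nat_eq (algebraMap F (AlgebraicClosure F) x) hn
  have hy0 : y ≠ 0 := by
    rintro rfl
    rw [zero_pow hn.ne'] at hy
    exact hx ((map_eq_zero _).1 hy.symm)
  -- Multiplying y by a root of unity changes no absolute value under any embedding, and |y|^n = |x|
  -- ≤ r(v)^n.
  refine ((infinite_setOf_pow_eq_one (AlgebraicClosure F)).image
    (f := fun z => y * z) (mul_right_injective₀ hy0).injOn).mono ?_
  rintro _ ⟨z, ⟨k, hk, hz⟩, rfl⟩ v τ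
  have hz1 : v.nabs (τ z) = 1 := by
    rw [← pow_eq_one_iff_of_nonneg (v.nabs_nonneg _) hk.ne', ← v.nabs_pow, ← map_pow, hz, map_one,
      v.nabs_one]
  rw [map_mul, v.nabs_mul, hz1, mul_one]
  refine le_of_pow_le_pow_left₀ hn.ne' (hr v).le ?_
  rw [← v.nabs_pow, ← map_pow, hy, τ.commutes]
  exact hle v

end GlobalField

/-! ### Density of the fibres over a box under an integral extension of a polynomial ring. -/

section Extension

open TensorProduct

/-- Points of an integral extension of a polynomial ring over an algebraically closed field which
lie over a given box with infinite sides are Zariski dense. -/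
theorem exists_ringHom_apply_ne_zero {d : ℕ} {K C : Type} [Field K] [IsAlgClosed K] [CommRing C]
    [IsDomain C] [Algebra (MvPolynomial (Fin d) K) C]
    [Algebra.IsIntegral (MvPolynomial (Fin d) K) C] [FaithfulSMul (MvPolynomial (Fin d) K) C]
    (S : Set K) (hS : S.Infinite) {y : C} (hy : y ≠ 0) :
    ∃ χ : C →+* K, χ y ≠ 0 ∧
      (∀ c, χ (algebraMap (MvPolynomial (Fin d) K) C (MvPolynomial.C c)) = c) ∧
      ∀ j, χ (algebraMap (MvPolynomial (Fin d) K) C (MvPolynomial.X j)) ∈ S := by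
  -- By integrality the ideal (y) contains a nonzero polynomial c. At a point over s with c(s) ≠ 0,
  -- y cannot vanish.
  obtain ⟨c, hc, hc0⟩ := Submodule.exists_mem_ne_zero_of_ne_bot
    (Ideal.comap_ne_bot_of_integral_mem (R := MvPolynomial (Fin d) K) hy
      (Ideal.mem_span_singleton_self y) (Algebra.IsIntegral.isIntegral y))
  obtain ⟨s, hs, hcs⟩ : ∃ s : Fin d → K, (∀ j, s j ∈ S) ∧ MvPolynomial.eval s c ≠ 0 := by
    by_contra! h
    refine hc0 (MvPolynomial.funext_set (fun _ => S) (fun _ => hS) fun x hx => ?_)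
    rw [map_zero]
    exact h x fun j => hx j trivial
  have hms : (RingHom.ker (MvPolynomial.eval s)).IsPrime := RingHom.ker_isPrime _
  -- Lying over provides a prime above the point s. Its quotient is integral over the algebraically
  -- closed field K, hence equal to K.
  obtain ⟨M, -, hM, hMs⟩ := Ideal.exists_ideal_over_prime_of_isIntegral
    (RingHom.ker (MvPolynomial.eval s)) (⊥ : Ideal C) (by
      rw [← RingHom.ker_eq_comap_bot, (RingHom.injective_iff_ker_eq_bot _).1
        (FaithfulSMul.algebraMap_injective (MvPolynomial (Fin d) K) C)]
      exact bot_le)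
  let α := algebraMap (MvPolynomial (Fin d) K) C
  let β : K →+* C ⧸ M := (Ideal.Quotient.mk M).comp (α.comp MvPolynomial.C)
  have hfac : β.comp (MvPolynomial.eval s) = (Ideal.Quotient.mk M).comp α := by
    refine RingHom.ext fun x => ?_
    have h1 : x - MvPolynomial.C (MvPolynomial.eval s x) ∈ M.comap α := by
      rw [show M.comap α = _ from hMs, RingHom.mem_ker, map_sub, MvPolynomial.eval_C, sub_self]
    rw [Ideal.mem_comap, map_sub] at h1
    exact ((Ideal.Quotient.eq).2 h1).symm
  have hβi : β.IsIntegral := by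
    refine RingHom.IsIntegral.tower_top (MvPolynomial.eval s) β ?_
    rw [hfac]
    exact RingHom.IsIntegral.trans _ _ (algebraMap_isIntegral_iff.2 inferInstance)
      (RingHom.isIntegral_of_surjective _ Ideal.Quotient.mk_surjective)
  let := β.toAlgebra
  have : Algebra.IsIntegral K (C ⧸ M) := ⟨hβi⟩
  have hβb : Function.Bijective β := IsAlgClosed.algebraMap_bijective_of_isIntegral
  let e : K ≃+* C ⧸ M := RingEquiv.ofBijective β hβb
  have hβe (x : K) : e.symm (β x) = x := e.symm_apply_apply x
  refine ⟨e.symm.toRingHom.comp (Ideal.Quotient.mk M), ?_, hβe, fun j => ?_⟩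
  · intro h0
    have h2 : y ∈ M := by
      refine Ideal.Quotient.eq_zero_iff_mem.1 (e.symm.injective ?_)
      rw [map_zero]
      exact h0
    have h3 : c ∈ RingHom.ker (MvPolynomial.eval s) := by
      rw [← hMs]
      exact (Ideal.span_singleton_le_iff_mem _).2 h2 hc
    exact hcs h3
  · have h1 : β (MvPolynomial.eval s (MvPolynomial.X j)) = _ :=
      congrArg (fun h : MvPolynomial (Fin d) K →+* C ⧸ M => h (MvPolynomial.X j)) hfac
    rw [MvPolynomial.eval_X] at h1
    have h2 : e.symm (Ideal.Quotient.mk M (α (MvPolynomial.X j))) = s j := by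
      rw [← hβe (s j), h1]
      rfl
    have h3 := hs j
    rw [← h2] at h3
    exact h3

/-- K[X] is integral over F[X] and is a domain, so an ideal of K[X] that contracts to zero is zero.
-/
lemma injective_of_comp_map {d : ℕ} {F K C : Type} [Field F] [Field K] [Algebra F K]
    [Algebra.IsAlgebraic F K] [CommRing C] [IsDomain C] (α : MvPolynomial (Fin d) K →+* C)
    (h : Function.Injective (α.comp (MvPolynomial.map (algebraMap F K)))) :
    Function.Injective α := by
  let := MvPolynomial.algebraMvPolynomial (σ := Fin d) (R := F) (S := K)
  have hint : Algebra.IsIntegral (MvPolynomial (Fin d) F) (MvPolynomial (Fin d) K) :=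
    ⟨fun x => MvPolynomial.isIntegral_iff_isIntegral_coeff.2 fun _ =>
      Algebra.IsIntegral.isIntegral _⟩
  have hker : (RingHom.ker α).comap
      (algebraMap (MvPolynomial (Fin d) F) (MvPolynomial (Fin d) K)) = ⊥ := by
    rw [RingHom.comap_ker]
    exact (RingHom.injective_iff_ker_eq_bot _).1 h
  exact (RingHom.injective_iff_ker_eq_bot _).2 (Ideal.eq_bot_of_comap_eq_bot hker)

/-- Points of a finite cover of affine space over the algebraic closure which lie over a given box
with infinite sides are Zariski dense. -/
theorem exists_algHom_productMap_ne_zero {d : ℕ} {F K B : Type} [Field F] [Field K] [Algebra F K]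
    [IsAlgClosed K] [Algebra.IsAlgebraic F K] [CommRing B] [IsDomain B] [Algebra F B]
    (ρ : MvPolynomial (Fin d) F →ₐ[F] B) (hρ : Function.Injective ρ)
    (hρi : ρ.toRingHom.IsIntegral) (S : Set K) (hS : S.Infinite) (g : B ⊗[F] K)
    (hg : ¬ IsNilpotent g) :
    ∃ φ : B →ₐ[F] K, Algebra.TensorProduct.productMap φ (AlgHom.id F K) g ≠ 0 ∧
      ∀ j, φ (ρ (MvPolynomial.X j)) ∈ S := by
  -- B ⊗ K need not be a domain or reduced, so the argument passes to the quotient by a prime that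
  -- avoids g.
  obtain ⟨P, hP, hgP⟩ : ∃ P : Ideal (B ⊗[F] K), P.IsPrime ∧ g ∉ P := by
    by_contra! h
    refine hg (mem_nilradical.1 ?_)
    rw [nilradical_eq_sInf, Submodule.mem_sInf]
    exact fun P hP => h P hP
  -- Going down along the flat map B → B ⊗ K replaces P by a smaller prime over (0). Then B, and
  -- with it the polynomial ring, embeds in the quotient.
  obtain ⟨Q, hQP, hQ, hQ0⟩ := Ideal.exists_ideal_le_liesOver_of_le (p := (⊥ : Ideal B))
    (q := P.under B) P bot_le
  have hgQ : g ∉ Q := fun h => hgP (hQP h)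
  obtain ⟨C, _, _, _, π, hπ, hker⟩ : ∃ (C : Type) (_ : CommRing C) (_ : IsDomain C)
      (_ : Algebra F C) (π : B ⊗[F] K →ₐ[F] C), Function.Surjective π ∧ ∀ x, π x = 0 ↔ x ∈ Q :=
    ⟨(B ⊗[F] K) ⧸ Q, inferInstance, inferInstance, inferInstance, Ideal.Quotient.mkₐ F Q,
      Ideal.Quotient.mk_surjective, fun x => Ideal.Quotient.eq_zero_iff_mem⟩
  let ι : B →ₐ[F] C := π.comp Algebra.TensorProduct.includeLeft
  let κ : K →ₐ[F] C := π.comp Algebra.TensorProduct.includeRight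
  have hι : Function.Injective ι := by
    rw [injective_iff_map_eq_zero]
    intro b hb
    have h1 : b ∈ Q.under B := (hker _).1 hb
    rwa [← hQ0.over, Ideal.mem_bot] at h1
  let α : MvPolynomial (Fin d) K →+* C := MvPolynomial.eval₂Hom κ
    fun j => ι (ρ (MvPolynomial.X j))
  have hα : α.comp (MvPolynomial.map (algebraMap F K)) = (ι.comp ρ).toRingHom := by
    refine MvPolynomial.ringHom_ext (fun c => ?_) fun j => ?_
    · have h2 := (ι.comp ρ).commutes c
      rw [MvPolynomial.algebraMap_eq] at h2
      simp only [RingHom.comp_apply, MvPolynomial.map_C, α, MvPolynomial.coe_eval₂Hom,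
        MvPolynomial.eval₂_C]
      exact (κ.commutes c).trans h2.symm
    · simp [α]
  have hαi : α.IsIntegral := by
    intro x
    obtain ⟨x, rfl⟩ := hπ x
    induction x using TensorProduct.induction_on with
    | zero => rw [map_zero]; exact RingHom.isIntegralElem_zero α
    | add x y hx hy => rw [map_add]; exact RingHom.IsIntegralElem.add α hx hy
    | tmul b c =>
      have h1 : b ⊗ₜ[F] c = (b ⊗ₜ 1) * (1 ⊗ₜ c) := by simp
      rw [h1, map_mul]
      refine RingHom.IsIntegralElem.mul α ?_ ?_
      · obtain ⟨f, hf, hfb⟩ := hρi b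
        refine ⟨f.map (MvPolynomial.map (algebraMap F K)), hf.map _, ?_⟩
        rw [Polynomial.eval₂_map, hα]
        have := congrArg ι.toRingHom hfb
        rwa [Polynomial.hom_eval₂, map_zero] at this
      · have : π (1 ⊗ₜ c) = α (MvPolynomial.C c) := by
          simp [α, κ]
        rw [this]
        exact RingHom.isIntegralElem_map α
  have hαinj : Function.Injective α := injective_of_comp_map (F := F) α (by
    rw [hα]
    exact hι.comp hρ)
  let := α.toAlgebra
  have : Algebra.IsIntegral (MvPolynomial (Fin d) K) C := ⟨hαi⟩
  have : FaithfulSMul (MvPolynomial (Fin d) K) C :=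
    (faithfulSMul_iff_algebraMap_injective _ _).2 hαinj
  obtain ⟨χ, hχg, hχC, hχX⟩ := exists_ringHom_apply_ne_zero (d := d) S hS
    (y := π g) fun h => hgQ ((hker g).1 h)
  have hχκ (c : K) : χ (κ c) = c := by
    have h1 : α (MvPolynomial.C c) = κ c := MvPolynomial.eval₂_C (κ : K →+* C) _ c
    rw [← h1]
    exact hχC c
  let ψ : B ⊗[F] K →ₐ[F] K :=
    { χ.comp π.toRingHom with
      commutes' := fun x => by
        have h1 : algebraMap F (B ⊗[F] K) x = 1 ⊗ₜ algebraMap F K x :=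
          ((Algebra.TensorProduct.includeRight : K →ₐ[F] B ⊗[F] K).commutes x).symm
        change χ (π _) = _
        rw [h1]
        exact hχκ _ }
  refine ⟨ψ.comp Algebra.TensorProduct.includeLeft, ?_, fun j => ?_⟩
  · have h1 : Algebra.TensorProduct.productMap (ψ.comp Algebra.TensorProduct.includeLeft)
        (AlgHom.id F K) = ψ := by
      refine Algebra.TensorProduct.ext' fun b c => ?_
      have h2 : ψ (1 ⊗ₜ c) = c := hχκ c
      rw [Algebra.TensorProduct.productMap_apply_tmul, AlgHom.id_apply]
      conv_lhs => rw [← h2]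
      rw [AlgHom.comp_apply, Algebra.TensorProduct.includeLeft_apply, ← map_mul]
      simp
    rw [h1]
    exact hχg
  · have h2 := hχX j
    rwa [show algebraMap (MvPolynomial (Fin d) K) C (MvPolynomial.X j) =
      ι (ρ (MvPolynomial.X j)) from MvPolynomial.eval₂_X (κ : K →+* C) _ j] at h2

end Extension

/-! ### Standard charts of projective space and their dimension. -/

section Charts

open HomogeneousLocalization

variable (F : Type) [Field F] {n : ℕ}

/-- The constants in the coordinate ring of the chart `y_i ≠ 0`. -/
def chartC (i : Fin (n + 1)) : F →+* Away (grading F n) (MvPolynomial.X i) :=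
  (fromZeroRingHom (grading F n) _).comp (algebraMap F (grading F n 0))

/-- The map from a polynomial ring to the coordinate ring of the chart `y_i ≠ 0`. -/
def chartHom (i : Fin (n + 1)) :
    MvPolynomial (Fin n) F →+* Away (grading F n) (MvPolynomial.X i) :=
  MvPolynomial.eval₂Hom (chartC F i) fun j => affineCoord F n i (i.succAbove j)

variable {F}

instance (i : Fin (n + 1)) : IsDomain (Away (grading F n) (MvPolynomial.X i)) := by
  have hle : Submonoid.powers (MvPolynomial.X i : MvPolynomial (Fin (n + 1)) F) ≤
      nonZeroDivisors _ :=
    powers_le_nonZeroDivisors_of_noZeroDivisors (MvPolynomial.X_ne_zero i)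
  have := IsLocalization.isDomain_localization hle
  exact (val_injective (𝒜 := grading F n)
    (Submonoid.powers (MvPolynomial.X i : MvPolynomial (Fin (n + 1)) F))).isDomain
    (algebraMap (Away (grading F n) (MvPolynomial.X i))
      (Localization (Submonoid.powers (MvPolynomial.X i : MvPolynomial (Fin (n + 1)) F))))

lemma val_affineCoord_mul (i j : Fin (n + 1)) :
    (affineCoord F n i j).val * algebraMap (MvPolynomial (Fin (n + 1)) F)
        (Localization (Submonoid.powers (MvPolynomial.X i))) (MvPolynomial.X i) =
      algebraMap (MvPolynomial (Fin (n + 1)) F)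
        (Localization (Submonoid.powers (MvPolynomial.X i))) (MvPolynomial.X j) := by
  rw [affineCoord, Away.val_mk, Localization.mk_eq_mk']
  have := IsLocalization.mk'_spec (Localization (Submonoid.powers
    (MvPolynomial.X i : MvPolynomial (Fin (n + 1)) F))) (MvPolynomial.X j)
    (⟨MvPolynomial.X i ^ 1, 1, rfl⟩ : Submonoid.powers
      (MvPolynomial.X i : MvPolynomial (Fin (n + 1)) F))
  simpa only [pow_one] using this

lemma val_chartC (i : Fin (n + 1)) (a : F) :
    (chartC F i a).val = algebraMap (MvPolynomial (Fin (n + 1)) F)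
      (Localization (Submonoid.powers (MvPolynomial.X i))) (MvPolynomial.C a) := by
  rw [← Localization.mk_one_eq_algebraMap]
  rfl

lemma affineCoord_self (i : Fin (n + 1)) : affineCoord F n i i = 1 := by
  apply val_injective
  rw [affineCoord, Away.val_mk, val_one]
  simp only [pow_one]
  exact Localization.mk_self (⟨MvPolynomial.X i, 1, pow_one _⟩ : Submonoid.powers
    (MvPolynomial.X i : MvPolynomial (Fin (n + 1)) F))

/-- For a homogeneous of degree m, the fraction a / X_i^m is the value of a at the affine
coordinates X_j / X_i, one of which is 1. -/
lemma chartHom_surjective (i : Fin (n + 1)) : Function.Surjective (chartHom F i) := by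
  let Φ : MvPolynomial (Fin (n + 1)) F →+* Away (grading F n) (MvPolynomial.X i) :=
    MvPolynomial.eval₂Hom (chartC F i) (affineCoord F n i)
  have hΦ (a) : Φ a ∈ (chartHom F i).range := by
    induction a using MvPolynomial.induction_on with
    | C a => exact ⟨MvPolynomial.C a, by simp [chartHom, Φ]⟩
    | add p q hp hq => rw [map_add]; exact add_mem hp hq
    | mul_X p j hp =>
      rw [map_mul]
      refine mul_mem hp ?_
      rw [show Φ (MvPolynomial.X j) = affineCoord F n i j from MvPolynomial.eval₂_X _ _ _]
      rcases Fin.eq_self_or_eq_succAbove i j with rfl | ⟨k, rfl⟩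
      · rw [affineCoord_self]; exact one_mem _
      · exact ⟨MvPolynomial.X k, MvPolynomial.eval₂_X _ _ _⟩
  intro x
  obtain ⟨m, a, ha, rfl⟩ := Away.mk_surjective _ (X_mem i) x
  suffices Φ a = Away.mk _ (X_mem i) m a ha by rw [← this]; exact hΦ a
  apply val_injective
  rw [Away.val_mk, Localization.mk_eq_mk', IsLocalization.eq_mk'_iff_mul_eq]
  let v : Away (grading F n) (MvPolynomial.X i) →+*
      Localization (Submonoid.powers (MvPolynomial.X i : MvPolynomial (Fin (n + 1)) F)) :=
    algebraMap _ _
  let A : MvPolynomial (Fin (n + 1)) F →+*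
      Localization (Submonoid.powers (MvPolynomial.X i : MvPolynomial (Fin (n + 1)) F)) :=
    algebraMap _ _
  have h1 : v (Φ a) = ∑ e ∈ a.support, A (MvPolynomial.C (a.coeff e)) *
      ∏ j, v (affineCoord F n i j) ^ e j := by
    change v (MvPolynomial.eval₂ _ _ a) = _
    rw [MvPolynomial.eval₂_eq', map_sum]
    refine Finset.sum_congr rfl fun e _ => ?_
    rw [map_mul, map_prod]
    simp only [map_pow]
    congr 1
  have h2 : A a = ∑ e ∈ a.support, A (MvPolynomial.C (a.coeff e)) *
      ∏ j, A (MvPolynomial.X j) ^ e j := by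
    conv_lhs => rw [← MvPolynomial.eval₂_eta a, MvPolynomial.eval₂_eq', map_sum]
    simp only [map_mul, map_prod, map_pow]
  change v (Φ a) * A (MvPolynomial.X i ^ m) = A a
  rw [h1, h2, Finset.sum_mul]
  refine Finset.sum_congr rfl fun e he => ?_
  have hdeg : ∑ j, e j = m := by
    have h3 := (MvPolynomial.mem_homogeneousSubmodule _ _).1 ha (MvPolynomial.mem_support_iff.1 he)
    rw [smul_eq_mul, mul_one] at h3
    rw [← h3, Finsupp.weight_apply, Finsupp.sum_fintype _ _ (fun _ => by simp)]
    simp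
  rw [mul_assoc, map_pow, ← hdeg, ← Finset.prod_pow_eq_pow_sum, ← Finset.prod_mul_distrib]
  congr 1
  refine Finset.prod_congr rfl fun j _ => ?_
  rw [← mul_pow]
  congr 1
  exact val_affineCoord_mul i j

/-- Dehomogenization, X_0 ↦ 1, is a left inverse. -/
lemma chartHom_zero_injective : Function.Injective (chartHom F (0 : Fin (n + 1))) := by
  let g : MvPolynomial (Fin (n + 1)) F →+* MvPolynomial (Fin n) F :=
    MvPolynomial.eval₂Hom MvPolynomial.C (Fin.cons 1 MvPolynomial.X)
  have hg : IsUnit (g (MvPolynomial.X 0)) := by simp [g]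
  let h : Localization.Away (MvPolynomial.X 0 : MvPolynomial (Fin (n + 1)) F) →+*
    MvPolynomial (Fin n) F := IsLocalization.Away.lift (MvPolynomial.X 0) hg
  have hh (a) : h (algebraMap _ _ a) = g a := IsLocalization.Away.lift_eq _ hg a
  have hid : (h.comp ((algebraMap (Away (grading F n) (MvPolynomial.X 0)) _).comp
      (chartHom F (0 : Fin (n + 1))))) = RingHom.id _ := by
    refine MvPolynomial.ringHom_ext (fun c => ?_) fun j => ?_
    · change h (chartHom F 0 (MvPolynomial.C c)).val = _
      rw [show chartHom F (0 : Fin (n + 1)) (MvPolynomial.C c) = chartC F 0 c from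
        MvPolynomial.eval₂_C _ _ _, val_chartC, hh]
      simp [g]
    · change h (chartHom F 0 (MvPolynomial.X j)).val = _
      rw [show chartHom F (0 : Fin (n + 1)) (MvPolynomial.X j) = affineCoord F n 0 _ from
        MvPolynomial.eval₂_X _ _ _]
      have := congrArg h (val_affineCoord_mul (F := F) 0 ((0 : Fin (n + 1)).succAbove j))
      rw [map_mul, hh, hh] at this
      simpa [g] using this
  intro a b hab
  have := congrArg (fun x : Away (grading F n) (MvPolynomial.X 0) => h x.val) hab
  have h1 := RingHom.congr_fun hid a
  have h2 := RingHom.congr_fun hid b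
  exact h1.symm.trans (this.trans h2)

/-- In an integral extension, strict inclusions of primes remain strict after contraction. -/
lemma ringKrullDim_le_quotient_ker {A B : Type} [CommRing A] [CommRing B] (ρ : A →+* B)
    (hρ : ρ.IsIntegral) : ringKrullDim B ≤ ringKrullDim (A ⧸ RingHom.ker ρ) := by
  let σ := RingHom.kerLift ρ
  have hσ : σ.IsIntegral := by
    refine RingHom.IsIntegral.tower_top (Ideal.Quotient.mk (RingHom.ker ρ)) σ ?_
    exact hρ
  let := σ.toAlgebra
  have : Algebra.IsIntegral (A ⧸ RingHom.ker ρ) B := ⟨hσ⟩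
  refine Order.krullDim_le_of_strictMono (PrimeSpectrum.comap σ) fun P Q h => ?_
  exact Ideal.IsIntegral.comap_lt_comap (R := A ⧸ RingHom.ker ρ) (A := B) (I := P.asIdeal) (J := Q.asIdeal) h

/-- The chart ring is a domain of dimension at most n. Dividing by a nonzero element would lower the
dimension below n, whereas the image has dimension at least that of B. -/
lemma injective_of_le_ringKrullDim (i : Fin (n + 1)) {B : Type} [CommRing B]
    (ρ : Away (grading F n) (MvPolynomial.X i) →+* B) (hρ : ρ.IsIntegral)
    (hB : (n : WithBot ℕ∞) ≤ ringKrullDim B) : Function.Injective ρ := by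
  rw [injective_iff_map_eq_zero]
  by_contra! h
  obtain ⟨r, hr, hr0⟩ := h
  have h1 := ringKrullDim_succ_le_of_surjective (Ideal.Quotient.mk (RingHom.ker ρ))
    Ideal.Quotient.mk_surjective (mem_nonZeroDivisors_of_ne_zero hr0)
    (Ideal.Quotient.eq_zero_iff_mem.2 hr)
  have h2 := ringKrullDim_le_of_surjective _ (chartHom_surjective (F := F) i)
  rw [MvPolynomial.ringKrullDim_of_isNoetherianRing, ringKrullDim_eq_zero_of_field, Nat.card_fin,
    zero_add] at h2
  have h3 := (add_le_add_left (hB.trans (ringKrullDim_le_quotient_ker ρ hρ)) 1).trans (h1.trans h2)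
  have h4 : n + 1 ≤ n := by exact_mod_cast h3
  lia

/-- The generic point of a chart is the generic point of projective space. -/
lemma asHomogeneousIdeal_awayι_eq_bot (i : Fin (n + 1))
    (x : Spec (.of (Away (grading F n) (MvPolynomial.X i))))
    (hx : x.asIdeal = ⊥) :
    ((Proj.awayι (grading F n) (MvPolynomial.X i) (X_mem i) one_pos) x).asHomogeneousIdeal = ⊥ := by
  set I := ((Proj.awayι (grading F n) (MvPolynomial.X i) (X_mem i) one_pos) x).asHomogeneousIdeal
    with hI
  apply HomogeneousIdeal.toIdeal_injective
  rw [HomogeneousIdeal.toIdeal_bot, eq_bot_iff]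
  intro g hg
  rw [Ideal.mem_bot]
  by_contra hg0
  obtain ⟨m, hm⟩ : ∃ m, MvPolynomial.homogeneousComponent m g ≠ 0 := by
    by_contra! h
    exact hg0 (by rw [← MvPolynomial.sum_homogeneousComponent g, Finset.sum_eq_zero fun i _ => h i])
  have hmem : MvPolynomial.homogeneousComponent m g ∈ I := by
    have := I.isHomogeneous m hg
    have h2 : ((DirectSum.decompose (grading F n) g m : grading F n m) :
        MvPolynomial (Fin (n + 1)) F) = MvPolynomial.homogeneousComponent m g :=
      MvPolynomial.decomposition.decompose'_apply g m
    rwa [h2] at this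
  -- The factor X_i makes the degree positive even when m = 0, and it is a unit on the chart.
  have hg'deg : MvPolynomial.homogeneousComponent m g * MvPolynomial.X i ∈ grading F n (m + 1) :=
    (MvPolynomial.homogeneousComponent_isHomogeneous m g).mul (MvPolynomial.isHomogeneous_X F i)
  have h1 : x ∈ Proj.awayι (grading F n) (MvPolynomial.X i) (X_mem i) one_pos ⁻¹ᵁ
      Proj.basicOpen (grading F n) (MvPolynomial.homogeneousComponent m g * MvPolynomial.X i) := by
    rw [Proj.awayι_preimage_basicOpen _ _ _ hg'deg (Nat.succ_pos m)]
    change _ ∉ x.asIdeal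
    rw [hx, Ideal.mem_bot]
    intro h0
    have h2 := congrArg HomogeneousLocalization.val h0
    rw [Away.val_mk, val_zero, Localization.mk_eq_mk', IsLocalization.mk'_eq_zero_iff] at h2
    obtain ⟨⟨_, k, rfl⟩, hk⟩ := h2
    have hX := MvPolynomial.X_ne_zero (R := F) i
    exact mul_ne_zero (pow_ne_zero k hX) (pow_ne_zero 1 (mul_ne_zero hm hX)) hk
  exact h1 (I.toIdeal.mul_mem_right _ hmem)

lemma mem_basicOpen_X (x : PP F n) : ∃ i, x ∈ Proj.basicOpen (grading F n) (MvPolynomial.X i) := by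
  have h := Proj.iSup_basicOpen_eq_top' (grading F n) (fun i : Fin (n + 1) => MvPolynomial.X i)
    (fun i => ⟨1, X_mem i⟩) (by
      rw [eq_top_iff]
      rintro p -
      induction p using MvPolynomial.induction_on with
      | C a =>
        exact Subalgebra.algebraMap_mem _ (⟨MvPolynomial.C a, MvPolynomial.isHomogeneous_C _ a⟩ :
          grading F n 0)
      | add p q hp hq => exact add_mem hp hq
      | mul_X p j hp => exact mul_mem hp (Algebra.subset_adjoin ⟨j, rfl⟩))
  have h1 : x ∈ (⊤ : (PP F n).Opens) := trivial
  rw [← h] at h1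
  exact TopologicalSpace.Opens.mem_iSup.1 h1

end Charts

/-! ### Finite morphisms to projective space are dominant when the dimensions agree. -/

section FiniteCover

open HomogeneousLocalization TensorProduct

variable {F : Type} [Field F] {X : Scheme.{0}} {n : ℕ}

/-- The inverse image of a chart of projective space under a finite morphism is affine, and its
coordinate ring is integral over that of the chart. -/
lemma exists_chart (π : X ⟶ PP F n) [IsFinite π] (i : Fin (n + 1)) :
    ∃ (B : CommRingCat.{0}) (j : Spec B ⟶ X)
      (ρ : Away (grading F n) (MvPolynomial.X i) →+* B), IsOpenImmersion j ∧ ρ.IsIntegral ∧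
      j ≫ π = Spec.map (CommRingCat.ofHom ρ) ≫
        Proj.awayι (grading F n) (MvPolynomial.X i) (X_mem i) one_pos ∧
      ∀ x, π x ∈ Proj.basicOpen (grading F n) (MvPolynomial.X i) → x ∈ Set.range j := by
  let ι := Proj.awayι (grading F n) (MvPolynomial.X i) (X_mem i) one_pos
  let Y := Limits.pullback π ι
  have hY : IsAffine Y := isAffine_of_isAffineHom (Limits.pullback.snd π ι)
  let j : Spec Γ(Y, ⊤) ⟶ X := Y.isoSpec.inv ≫ Limits.pullback.fst π ι
  let h : Spec Γ(Y, ⊤) ⟶ Spec (.of (Away (grading F n) (MvPolynomial.X i))) :=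
    Y.isoSpec.inv ≫ Limits.pullback.snd π ι
  obtain ⟨ρ, hρ⟩ := Spec.map_surjective h
  refine ⟨Γ(Y, ⊤), j, ρ.hom, inferInstance, ?_, ?_, ?_⟩
  · have hfin : IsFinite h := inferInstance
    rw [← hρ, IsFinite.SpecMap_iff] at hfin
    exact hfin.to_isIntegral
  · rw [CommRingCat.ofHom_hom, hρ]
    simp only [j, h, Category.assoc, Limits.pullback.condition]
    rfl
  · intro x hx
    have h1 : x ∈ Set.range (Limits.pullback.fst π ι) := by
      rw [Scheme.Pullback.range_fst, Set.mem_preimage]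
      rw [← Proj.opensRange_awayι _ _ (X_mem i) one_pos] at hx
      exact hx
    obtain ⟨y, rfl⟩ := h1
    refine ⟨Y.isoSpec.hom y, ?_⟩
    rw [← Scheme.Hom.comp_apply]
    simp [j]

/-- If the smallest member of a chain of irreducible closed sets meets an open set, then all members
do, and their traces remain distinct. This transfers the dimension of X to a suitable chart. -/
lemma le_ringKrullDim_of_isOpenImmersion {B : CommRingCat.{0}} (j : Spec B ⟶ X) [IsOpenImmersion j]
    (l : LTSeries (TopologicalSpace.IrreducibleCloseds X)) {x : X} (hx : x ∈ l.head)
    (hxj : x ∈ Set.range j) : (l.length : WithBot ℕ∞) ≤ ringKrullDim B := by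
  rw [← PrimeSpectrum.topologicalKrullDim_eq_ringKrullDim]
  have hj : Topology.IsOpenEmbedding j := j.isOpenEmbedding
  have hmem (k) : (j ⁻¹' (l k : Set X)).Nonempty := by
    obtain ⟨y, rfl⟩ := hxj
    exact ⟨y, l.head_le k hx⟩
  let l' : LTSeries {V : TopologicalSpace.IrreducibleCloseds X | (j ⁻¹' (V : Set X)).Nonempty} :=
    LTSeries.mk l.length (fun k => ⟨l k, hmem k⟩) fun a b hab => l.strictMono hab
  let e := TopologicalSpace.IrreducibleCloseds.orderIsoOfIsOpenEmbedding j hj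
  exact Order.LTSeries.length_le_krullDim (l'.map e.symm e.symm.strictMono)

/-- A finite morphism from a variety of dimension `n` to projective `n`-space maps the generic
point to the generic point. -/
lemma asHomogeneousIdeal_genericPoint_eq_bot [IsIntegral X] (hdim : topologicalKrullDim X = n)
    (π : X ⟶ PP F n) [IsFinite π] : (π (genericPoint X)).asHomogeneousIdeal = ⊥ := by
  obtain ⟨l, hl⟩ := Order.le_krullDim_iff.1 hdim.ge
  -- The chart must meet the bottom of a chain of length n, so that it inherits the full dimension.
  obtain ⟨x, hx⟩ := l.head.isIrreducible.nonempty
  obtain ⟨i, hi⟩ := mem_basicOpen_X (π x)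
  obtain ⟨B, j, ρ, hj, hρ, hcomp, hrange⟩ := exists_chart π i
  have hinj := injective_of_le_ringKrullDim i ρ hρ
    (hl ▸ le_ringKrullDim_of_isOpenImmersion j l hx (hrange x hi))
  obtain ⟨y, hy⟩ := hrange x hi
  have : Nonempty (Spec B) := ⟨y⟩
  have hB : IsIntegral (Spec B) := isIntegral_of_isOpenImmersion j
  have hgen : j (genericPoint (Spec B)) = genericPoint X := genericPoint_eq_of_isOpenImmersion j
  rw [← hgen, ← Scheme.Hom.comp_apply, hcomp, Scheme.Hom.comp_apply]
  apply asHomogeneousIdeal_awayι_eq_bot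
  have hdom : IsDomain B := (affine_isIntegral_iff B).1 hB
  rw [genericPoint_eq_bot_of_affine]
  change (⊥ : Ideal B).comap ρ = ⊥
  rw [← RingHom.ker_eq_comap_bot]
  exact (RingHom.injective_iff_ker_eq_bot _).1 hinj

/-- The affine chart of a finite cover of projective space. -/
lemma exists_injective_chart [IsIntegral X] (hdim : topologicalKrullDim X = n)
    (π : X ⟶ PP F n) [IsFinite π] (i : Fin (n + 1)) :
    ∃ (B : CommRingCat.{0}) (j : Spec B ⟶ X)
      (ρ : Away (grading F n) (MvPolynomial.X i) →+* B), IsDomain B ∧ IsOpenImmersion j ∧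
      ρ.IsIntegral ∧ Function.Injective ρ ∧ j ≫ π = Spec.map (CommRingCat.ofHom ρ) ≫
        Proj.awayι (grading F n) (MvPolynomial.X i) (X_mem i) one_pos ∧
      genericPoint X ∈ Set.range j := by
  obtain ⟨B, j, ρ, hj, hρ, hcomp, hrange⟩ := exists_chart π i
  -- Since the generic point maps to the zero ideal, no coordinate vanishes there. Hence every chart
  -- contains the generic point, and injectivity follows without computing the dimension of this
  -- particular chart.
  have hbot := asHomogeneousIdeal_genericPoint_eq_bot hdim π
  have hmem : genericPoint X ∈ Set.range j := by
    apply hrange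
    rw [Proj.mem_basicOpen, hbot]
    exact MvPolynomial.X_ne_zero i
  obtain ⟨y, hy⟩ := hmem
  have : Nonempty (Spec B) := ⟨y⟩
  have hB : IsIntegral (Spec B) := isIntegral_of_isOpenImmersion j
  have hdom : IsDomain B := (affine_isIntegral_iff B).1 hB
  refine ⟨B, j, ρ, hdom, hj, hρ, ?_, hcomp, y, hy⟩
  have hgen : j (genericPoint (Spec B)) = genericPoint X := genericPoint_eq_of_isOpenImmersion j
  let ι := Proj.awayι (grading F n) (MvPolynomial.X i) (X_mem i) one_pos
  let b : Spec (.of (Away (grading F n) (MvPolynomial.X i))) :=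
    (⊥ : PrimeSpectrum (Away (grading F n) (MvPolynomial.X i)))
  have h1 : ι (Spec.map (CommRingCat.ofHom ρ) (genericPoint (Spec B))) = ι b := by
    apply ProjectiveSpectrum.ext
    rw [asHomogeneousIdeal_awayι_eq_bot i b rfl, ← Scheme.Hom.comp_apply, ← hcomp,
      Scheme.Hom.comp_apply, hgen, hbot]
  have h2 : Spec.map (CommRingCat.ofHom ρ) (genericPoint (Spec B)) = b :=
    ι.isOpenEmbedding.injective h1
  rw [genericPoint_eq_bot_of_affine] at h2
  have h3 : (⊥ : Ideal B).comap ρ = ⊥ := congrArg PrimeSpectrum.asIdeal h2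
  rw [← RingHom.ker_eq_comap_bot] at h3
  exact (RingHom.injective_iff_ker_eq_bot _).2 h3

end FiniteCover

/-! ### Zariski density in the base change, tested on one affine chart. -/

section Density

open TensorProduct

variable {F : Type} [Field F] {X : Scheme.{0}} {f : X ⟶ Spec (.of F)}

/-- A set of points is Zariski dense if it contains, for every nonempty open subset of the base
change of one affine chart, a point which lies in it. -/
lemma isZariskiDense_of_chart [IsIntegral X] {K B : Type} [Field K] [Algebra F K] [CommRing B]
    [Algebra F B] (j : Spec (.of B) ⟶ X) [IsOpenImmersion j]
    (hj : j ≫ f = Spec.map (CommRingCat.ofHom (algebraMap F B)))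
    (hgen : genericPoint X ∈ Set.range j) (S : Set (Points f K))
    (hS : ∀ g : B ⊗[F] K, ¬ IsNilpotent g → ∃ φ : B →ₐ[F] K,
      Algebra.TensorProduct.productMap φ (AlgHom.id F K) g ≠ 0 ∧
      ∃ x ∈ S, x.1 = Spec.map (CommRingCat.ofHom φ.toRingHom) ≫ j) :
    IsZariskiDense S := by
  let s := Spec.map (CommRingCat.ofHom (algebraMap F K))
  let p₁ := Limits.pullback.fst f s
  let p₂ := Limits.pullback.snd f s
  let iL := Spec.map (CommRingCat.ofHom
    (Algebra.TensorProduct.includeLeftRingHom : B →+* B ⊗[F] K))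
  let iR := Spec.map (CommRingCat.ofHom
    (Algebra.TensorProduct.includeRight : K →ₐ[F] B ⊗[F] K).toRingHom)
  have hcomm : (iL ≫ j) ≫ f = iR ≫ s := by
    rw [Category.assoc, hj, ← Spec.map_comp, ← Spec.map_comp, ← CommRingCat.ofHom_comp,
      ← CommRingCat.ofHom_comp]
    congr 2
    ext a
    exact (Algebra.TensorProduct.includeLeft : B →ₐ[F] B ⊗[F] K).commutes a |>.trans
      ((Algebra.TensorProduct.includeRight : K →ₐ[F] B ⊗[F] K).commutes a).symm
  let ι : Spec (.of (B ⊗[F] K)) ⟶ Limits.pullback f s := Limits.pullback.lift (iL ≫ j) iR hcomm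
  have hι₁ : ι ≫ p₁ = iL ≫ j := Limits.pullback.lift_fst _ _ _
  have hι₂ : ι ≫ p₂ = iR := Limits.pullback.lift_snd _ _ _
  -- The base change of the chart is Spec (B ⊗ K), so every point of X_K over the chart comes from
  -- it.
  have hrange (y) (hy : p₁ y ∈ Set.range j) : ∃ z, ι z = y := by
    obtain ⟨b, hb⟩ := hy
    obtain ⟨u, hu, -⟩ := Scheme.Pullback.exists_preimage_pullback (f := p₁) (g := j) y b hb.symm
    let q : Limits.pullback p₁ j ⟶ Limits.pullback
        (Spec.map (CommRingCat.ofHom (algebraMap F B))) s :=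
      Limits.pullback.lift (Limits.pullback.snd p₁ j) (Limits.pullback.fst p₁ j ≫ p₂) (by
        rw [← hj, ← Limits.pullback.condition_assoc, Category.assoc, ← Limits.pullback.condition])
    let θ := q ≫ (pullbackSpecIso F B K).hom
    have hθ : θ ≫ ι = Limits.pullback.fst p₁ j := by
      apply Limits.pullback.hom_ext
      · change (θ ≫ ι) ≫ p₁ = Limits.pullback.fst p₁ j ≫ p₁
        rw [Category.assoc, hι₁, Limits.pullback.condition]
        have : θ ≫ iL = Limits.pullback.snd p₁ j := by
          simp only [θ, iL, Category.assoc]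
          rw [pullbackSpecIso_hom_fst]
          exact Limits.pullback.lift_fst _ _ _
        rw [← this]
        exact (Category.assoc _ _ _).symm
      · change (θ ≫ ι) ≫ p₂ = Limits.pullback.fst p₁ j ≫ p₂
        rw [Category.assoc, hι₂]
        simp only [θ, iR, Category.assoc]
        refine (congrArg (q ≫ ·) (pullbackSpecIso_hom_snd F B K)).trans ?_
        exact Limits.pullback.lift_snd _ _ _
    refine ⟨θ u, ?_⟩
    rw [← Scheme.Hom.comp_apply, hθ, hu]
  have hflat : Flat s := by
    rw [Flat.SpecMap_iff]
    exact (RingHom.flat_algebraMap_iff).2 inferInstance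
  have hgz : GeneralizingMap p₁ := Flat.generalizingMap p₁
  rw [IsZariskiDense, dense_iff_inter_open]
  rintro V hV ⟨y, hy⟩
  -- The projection X_K → X is flat, so generalizations lift. Every nonempty open set thus contains
  -- a point over the generic point of X, and so meets the chart.
  obtain ⟨y', hy', hyg⟩ := hgz (genericPoint_specializes (p₁ y))
  have hyV : y' ∈ V := hy'.mem_open hV hy
  obtain ⟨z, rfl⟩ := hrange y' (hyg ▸ hgen)
  obtain ⟨_, ⟨g, rfl⟩, hzg, hgV⟩ := PrimeSpectrum.isTopologicalBasis_basic_opens.exists_subset_of_mem_open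
    (show z ∈ ι ⁻¹' V from hyV) (hV.preimage ι.continuous)
  have hg : ¬ IsNilpotent g := by
    rintro ⟨k, hk⟩
    exact hzg (z.isPrime.mem_of_pow_mem k (hk ▸ zero_mem z.asIdeal))
  obtain ⟨φ, hφg, x, hxS, hx⟩ := hS g hg
  refine ⟨x.geomPt, ?_, x, hxS, rfl⟩
  let m : B ⊗[F] K →+* K := (Algebra.TensorProduct.productMap φ (AlgHom.id F K)).toRingHom
  have hlift : Limits.pullback.lift x.1 (𝟙 _) (by rw [x.2, Category.id_comp]) =
      Spec.map (CommRingCat.ofHom m) ≫ ι := by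
    apply Limits.pullback.hom_ext
    · rw [Limits.pullback.lift_fst]
      change x.1 = (_ ≫ ι) ≫ p₁
      rw [Category.assoc, hι₁, ← Category.assoc, ← Spec.map_comp, ← CommRingCat.ofHom_comp, hx]
      congr 3
      ext b
      simp [m]
    · rw [Limits.pullback.lift_snd]
      change 𝟙 _ = (_ ≫ ι) ≫ p₂
      rw [Category.assoc, hι₂, ← Spec.map_comp, ← CommRingCat.ofHom_comp, ← Spec.map_id]
      congr 1
      ext c
      simp [m]
  have h1 : x.geomPt = ι (Spec.map (CommRingCat.ofHom m) (IsLocalRing.closedPoint K)) :=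
    congrArg (fun h : Spec (.of K) ⟶ _ => h (IsLocalRing.closedPoint K)) hlift
  rw [h1]
  apply hgV
  change g ∉ (IsLocalRing.maximalIdeal K).comap m
  rw [Ideal.mem_comap, IsLocalRing.mem_maximalIdeal, mem_nonunits_iff, not_not]
  exact isUnit_iff_ne_zero.2 hφg

end Density

/-! ### From capacity larger than one to density. -/

section Capacity

variable {F : Type} [Field F]

lemma Radii.pos_of_one_lt_norm {r : Radii F} (h : 1 < r.norm) (v : Place F) : 0 < r.1 v := by
  refine lt_of_le_of_ne (r.2.1 v) fun h0 => ?_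
  have h1 : r.norm = 0 := by
    rw [Radii.norm, finprod_eq_prod_of_mulSupport_subset (s := r.2.2.toFinset) r.1 (by
      intro v hv
      simpa using hv)]
    refine Finset.prod_eq_zero (i := v) ?_ h0.symm
    rw [Set.Finite.mem_toFinset, Set.mem_ofPred_eq, ← h0]
    exact zero_ne_one
  rw [h1] at h
  exact absurd h (by norm_num)

/-- A supremum above 1 is exceeded by some term, and a nonnegative power of a number in [0, 1] is at
most 1. So the base |r| itself exceeds 1, whatever the degree of π. -/
lemma exists_of_one_lt_openCapacity {X : Scheme.{0}} [IsIntegral X] {f : X ⟶ Spec (.of F)}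
    {D : X.IdealSheafData} {d : ℕ} {U : AdelicFamily f} (h : 1 < openCapacity f D d U) :
    ∃ (π : X ⟶ PP F d) (_ : IsFinite π) (hπ : π ≫ PP.structureMorphism F d = f) (r : Radii F),
      1 < r.norm ∧ ∀ v, Points.push π hπ ⁻¹' polydisk d v (r.1 v) ⊆ U v := by
  simp only [openCapacity, lt_iSup_iff] at h
  obtain ⟨π, m, hπ, r, hr, h1⟩ := h
  refine ⟨π, hπ.finite, hπ.over_base, r, ?_, hr⟩
  rw [← ENNReal.ofReal_one, ENNReal.ofReal_lt_ofReal_iff_of_nonneg zero_le_one] at h1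
  by_contra! h2
  have h3 : 0 ≤ r.norm := finprod_nonneg r.2.1
  exact absurd h1 (not_lt.2 (Real.rpow_le_one h3 h2 (by positivity)))

/-- A point of a chart of a cover of projective space whose affine coordinates lie in given disks
maps to the polydisk. -/
lemma push_mem_polydisk {X : Scheme.{0}} {f : X ⟶ Spec (.of F)} {d : ℕ} {π : X ⟶ PP F d}
    (hπ : π ≫ PP.structureMorphism F d = f) {v : Place F} {ρ : ℝ} (x : Points f v.Cv)
    (φ : HomogeneousLocalization.Away (grading F d) (MvPolynomial.X 0) →+* v.Cv)
    (hx : x.1 ≫ π = Spec.map (CommRingCat.ofHom φ) ≫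
      Proj.awayι (grading F d) (MvPolynomial.X 0) (X_mem 0) one_pos)
    (hφ : ∀ k : Fin d, v.nabs (φ (affineCoord F d 0 k.succ)) ≤ ρ) :
    x.push π hπ ∈ polydisk d v ρ := by
  refine ⟨Fin.cons 1 fun k => φ (affineCoord F d 0 k.succ), ⟨0, ?_, φ, fun j => ?_, hx⟩, ?_, ?_⟩
  · rw [Fin.cons_zero]; exact one_ne_zero
  · rw [Fin.cons_zero, div_one]
    refine Fin.cases ?_ (fun k => ?_) j
    · rw [Fin.cons_zero, affineCoord_self, map_one]
    · rw [Fin.cons_succ]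
  · rw [Fin.cons_zero]
  · intro k
    rw [Fin.cons_succ]
    exact hφ k

/-- If the capacity of the adelic set `U` is larger than one, then the points all of whose
conjugates lie in `U` are Zariski dense. -/
theorem isZariskiDense_conjugatesIn (hF : IsGlobalField F) {X : Scheme.{0}} [IsIntegral X]
    {f : X ⟶ Spec (.of F)} {D : X.IdealSheafData} {d : ℕ} (hdim : topologicalKrullDim X = d)
    {U : AdelicFamily f} (hU : 1 < openCapacity f D d U) :
    IsZariskiDense (conjugatesIn U) := by
  obtain ⟨π, hfin, hπ, r, hr, hU'⟩ := exists_of_one_lt_openCapacity hU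
  obtain ⟨B, j, ρ, hdom, hj, hρi, hρ, hcomp, hgen⟩ := exists_injective_chart hdim π 0
  have hbase : j ≫ f = Spec.map (CommRingCat.ofHom (ρ.comp (chartC F 0))) := by
    rw [← hπ, ← Category.assoc, hcomp, Category.assoc, PP.structureMorphism,
      Proj.awayι_toSpecZero_assoc, ← Spec.map_comp, ← Spec.map_comp, ← CommRingCat.ofHom_comp,
      ← CommRingCat.ofHom_comp]
    rfl
  let : Algebra F B := (ρ.comp (chartC F 0)).toAlgebra
  let σ : MvPolynomial (Fin d) F →ₐ[F] B :=
    { ρ.comp (chartHom F 0) with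
      commutes' := fun a => congrArg ρ (MvPolynomial.eval₂_C _ _ a) }
  have hσ (k : Fin d) : σ (MvPolynomial.X k) = ρ (affineCoord F d 0 k.succ) := by
    change ρ (chartHom F 0 (MvPolynomial.X k)) = _
    rw [chartHom, MvPolynomial.coe_eval₂Hom, MvPolynomial.eval₂_X, Fin.zero_succAbove]
  have hinf := infinite_conjugates_in_disks hF r.1 (Radii.pos_of_one_lt_norm hr) r.2.2 hr
  refine isZariskiDense_of_chart (B := B) j hbase hgen _ fun g hg => ?_
  -- The affine coordinates of the point are taken in the infinite set of numbers with all
  -- conjugates in the disks; composing with any embedding τ therefore lands in the polydisk.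
  obtain ⟨φ, hφg, hφ⟩ := exists_algHom_productMap_ne_zero σ (hρ.comp chartHom_zero_injective)
    ((RingHom.isIntegral_of_surjective _ (chartHom_surjective 0)).trans _ _ hρi) _ hinf g hg
  refine ⟨φ, hφg, ⟨Spec.map (CommRingCat.ofHom φ.toRingHom) ≫ j, ?_⟩, ?_, rfl⟩
  · rw [Category.assoc, hbase, ← Spec.map_comp, ← CommRingCat.ofHom_comp]
    congr 2
    exact φ.comp_algebraMap
  · intro v τ
    apply hU' v
    refine push_mem_polydisk hπ _ ((τ.toRingHom.comp φ.toRingHom).comp ρ) ?_ fun k => ?_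
    · simp only [Points.baseChange, Category.assoc, hcomp, CommRingCat.ofHom_comp, Spec.map_comp]
    · have := hφ k v τ
      rw [hσ] at this
      exact this

end Capacity

end

end FiniteMorphismCapacity

theorem mainTheorem2 (F : Type) [Field F] (hF : FiniteMorphismCapacity.IsGlobalField F)
    (X : Scheme.{0}) [IsIntegral X] (hX : FiniteMorphismCapacity.IsNormalScheme X)
    (f : X ⟶ Spec (.of F)) (d : ℕ) (hd : 1 ≤ d) (hdim : topologicalKrullDim X = d)
    (t : ℕ) (i : X ⟶ FiniteMorphismCapacity.PP F t) (hclosed : IsClosedImmersion i)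
    (hi : i ≫ FiniteMorphismCapacity.PP.structureMorphism F t = f)
    (D : X.IdealSheafData) (hD : FiniteMorphismCapacity.IsEffectiveCartier D)
    (hample : FiniteMorphismCapacity.IsAmple f D)
    (E : FiniteMorphismCapacity.AdelicFamily f)
    (hE : FiniteMorphismCapacity.StandardHypotheses i hi D E)
    (hcap : 1 < FiniteMorphismCapacity.capacity i hi D d E)
    (U : FiniteMorphismCapacity.AdelicFamily f)
    (hU : U ∈ FiniteMorphismCapacity.openNeighborhoods i hi D E) :
    FiniteMorphismCapacity.IsZariskiDense (FiniteMorphismCapacity.conjugatesIn U) :=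
  FiniteMorphismCapacity.isZariskiDense_conjugatesIn hF hdim (hcap.trans_le (iInf₂_le U hU))
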